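/- Let $d \ge 2$ and $1 \le k \le d-1$ be integers, let $\mathbb K$ be a field, and let $f$ be a bounded probability density function on $\mathbb R^d$. For each $n \in \mathbb N$ let $\mathcal P_n$ be a Poisson point process on $\mathbb R^d$ with intensity function $x \mapsto n f(x)$. For $r>0$ and $P \subseteq \mathbb R^d$ let $\operatorname{\check{C}ech}_r(P)$ be the simplicial complex of all nonempty finite $Q \subseteq P$ with $\bigcap_{x\in Q} \overline B_r(x) \ne \emptyset$, and let $\beta_k(P,r) = \operatorname{rank} H_k(\operatorname{\check{C}ech}_r(P);\mathbb K)$. For $\vartheta \ge 1$ let $m(\vartheta,k)$ be the least number of points of a finite set $P \subset \mathbb R^d$ for which there are an $r>0$ and a $k$-cycle of $\operatorname{\check{C}ech}_r(P)$ with coefficients in $\mathbb K$ that is not a boundary in $\operatorname{\check{C}ech}_{\vartheta r}(P)$. Then $m(1,k) = k+2$. Moreover, if $(r_n)_{n\in\mathbb N}$ is a sequence of positive reals with $r_n^d\, n \to 0$ as $n \to \infty$, then $\beta_k(\mathcal P_n,r_n)$ is integrable for every $n$, and $$ E\big(\beta_k(\mathcal P_n, r_n)\big) \in \Theta\big( n\,(r_n^d\,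 n)^{k+1} \big) \qquad (n \to \infty), $$ that is, there are constants $C > c > 0$ and an $n_0$ with $c\, n (r_n^d n)^{k+1} \le E(\beta_k(\mathcal P_n,r_n)) \le C\, n (r_n^d n)^{k+1}$ for all $n \ge n_0$. -/

import Mathlib

open MeasureTheory ProbabilityTheory Filter Topology Asymptotics

namespace RandomCech

/-! ### Simplicial homology with field coefficients -/

section Homology

/-- The quotient `Z / (B ∩ Z)` of submodules of a module. -/
abbrev Subquotient {R M : Type*} [Ring R] [AddCommGroup M] [Module R M] (Z B : Submodule R M) :
    Type _ :=
  Z ⧸ B.submoduleOf Z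

variable (𝕂 : Type*) [Field 𝕂] {V : Type*}

/-- The `k`-chains `C_k(K; 𝕂)` of a simplicial complex `K`, as finitely supported functions `c`
on ordered `k`-simplices `(v₀, …, v_k)` of `K` (the `vᵢ` distinct and spanning a face of `K`)
that are alternating: `c` is multiplied by `sign π` when the vertices are permuted by `π`. These are
exactly the finitely supported functions on oriented `k`-simplices with `c(-σ) = -c(σ)`. -/
def chains (K : PreAbstractSimplicialComplex V) (k : ℕ) :
    Submodule 𝕂 ((Fin (k + 1) → V) →₀ 𝕂) where
  carrier := {c |
    (∀ σ, c σ ≠ 0 → Function.Injective σ ∧ ∃ s ∈ K.faces, (s : Set V) = Set.range σ) ∧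
    ∀ (π : Equiv.Perm (Fin (k + 1))) (σ : Fin (k + 1) → V),
      c (σ ∘ π) = Equiv.Perm.sign π • c σ}
  zero_mem' := by simp
  add_mem' := by
    rintro a b ⟨ha, ha'⟩ ⟨hb, hb'⟩
    refine ⟨fun σ h => ?_, fun π σ => by simp [ha' π σ, hb' π σ]⟩
    by_cases h0 : a σ = 0
    · exact hb σ (by simpa [h0] using h)
    · exact ha σ h0
  smul_mem' := by
    rintro t a ⟨ha, ha'⟩
    refine ⟨fun σ h => ha σ fun h0 => h (by simp [h0]), fun π σ => ?_⟩
    simp only [Finsupp.smul_apply, ha' π σ, smul_comm t]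

/-- The boundary operator, `(∂c)(v₁, …, v_{k+1}) = ∑_v c(v, v₁, …, v_{k+1})`. By
`boundary_orientedSimplex` below, this is the usual alternating sum of faces on each oriented
simplex. -/
noncomputable def boundary (V : Type*) (k : ℕ) :
    ((Fin (k + 2) → V) →₀ 𝕂) →ₗ[𝕂] ((Fin (k + 1) → V) →₀ 𝕂) :=
  Finsupp.lmapDomain 𝕂 𝕂 (fun σ => Fin.tail σ)

/-- The oriented simplex `[v₀, …, v_k]` as an alternating function. -/
noncomputable def orientedSimplex {k : ℕ} (σ : Fin (k + 1) → V) : (Fin (k + 1) → V) →₀ 𝕂 :=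
  ∑ π : Equiv.Perm (Fin (k + 1)), Equiv.Perm.sign π • Finsupp.single (σ ∘ π) (1 : 𝕂)

/-- `∂[v₀, …, v_{k+1}] = ∑ i, (-1)^i [v₀, …, v̂ᵢ, …, v_{k+1}]`. -/
theorem boundary_orientedSimplex {k : ℕ} (σ : Fin (k + 2) → V) :
    boundary 𝕂 V k (orientedSimplex 𝕂 σ) =
      ∑ i : Fin (k + 2), (-1 : 𝕂) ^ (i : ℕ) • orientedSimplex 𝕂 (σ ∘ i.succAbove) := by
  let F : Fin (k + 2) × Equiv.Perm (Fin (k + 1)) → Equiv.Perm (Fin (k + 2)) :=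
    fun p => p.1.cycleRange.symm * Equiv.Perm.decomposeFin.symm (0, p.2)
  have F0 : ∀ p, F p 0 = p.1 := fun p => by simp [F]
  have Fs : ∀ p j, F p (Fin.succ j) = p.1.succAbove (p.2 j) := fun p j => by simp [F]
  have hF : Function.Bijective F := by
    rw [Fintype.bijective_iff_injective_and_card]
    refine ⟨fun p q h => ?_, ?_⟩
    · have h1 : p.1 = q.1 := by rw [← F0 p, ← F0 q, h]
      refine Prod.ext h1 (Equiv.ext fun j => ?_)
      have h2 := congrArg (fun e => e (Fin.succ j)) h
      simp only [Fs, h1] at h2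
      exact Fin.succAbove_right_injective h2
    · simp [Fintype.card_perm, Nat.factorial_succ]
  have hsign : ∀ p, Equiv.Perm.sign (F p) = (-1) ^ (p.1 : ℕ) * Equiv.Perm.sign p.2 := fun p => by
    simp [F, Equiv.Perm.decomposeFin.symm_sign]
  have htail : ∀ p, Fin.tail (σ ∘ F p) = (σ ∘ p.1.succAbove) ∘ p.2 := fun p => by
    funext j
    simp [Fin.tail, Fs]
  unfold orientedSimplex boundary
  rw [map_sum, ← (Equiv.ofBijective F hF).sum_comp, Fintype.sum_prod_type]
  refine Finset.sum_congr rfl fun i _ => ?_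
  rw [Finset.smul_sum]
  refine Finset.sum_congr rfl fun π _ => ?_
  simp only [Equiv.ofBijective_apply, hsign, Units.smul_def, map_zsmul,
    Finsupp.lmapDomain_apply, Finsupp.mapDomain_single, htail]
  ext τ
  simp

variable {𝕂}

theorem boundary_mem_chains {K : PreAbstractSimplicialComplex V} {k : ℕ}
    {c : (Fin (k + 2) → V) →₀ 𝕂} (hc : c ∈ chains 𝕂 K (k + 1)) :
    boundary 𝕂 V k c ∈ chains 𝕂 K k := by
  classical
  obtain ⟨h1, h2⟩ := hc
  refine ⟨fun τ hτ => ?_, fun π τ => ?_⟩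
  · have hm := Finsupp.mapDomain_support (Finsupp.mem_support_iff.2 hτ)
    obtain ⟨σ, hσ, rfl⟩ := Finset.mem_image.1 hm
    obtain ⟨hi, s, hs, hsr⟩ := h1 σ (Finsupp.mem_support_iff.1 hσ)
    refine ⟨fun a b h => Fin.succ_injective _ (hi h), Finset.univ.image (Fin.tail σ), ?_, by simp⟩
    refine (K.isRelLowerSet_faces hs).2 ?_ ⟨_, Finset.mem_image_of_mem _ (Finset.mem_univ 0)⟩
    intro x hx
    obtain ⟨j, -, rfl⟩ := Finset.mem_image.1 hx
    exact Finset.mem_coe.1 (hsr ▸ ⟨j.succ, rfl⟩)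
  · let ρ := Equiv.Perm.decomposeFin.symm ((0 : Fin (k + 2)), π)
    have hρ : Equiv.Perm.sign ρ = Equiv.Perm.sign π := by
      simp [ρ, Equiv.Perm.decomposeFin.symm_sign]
    let e₁ : (Fin (k + 2) → V) ≃ (Fin (k + 2) → V) := (ρ.arrowCongr (Equiv.refl V))
    let e₀ : (Fin (k + 1) → V) ≃ (Fin (k + 1) → V) := (π.arrowCongr (Equiv.refl V))
    have key : Finsupp.mapDomain e₁ c = Equiv.Perm.sign π • c := by
      ext σ
      have : Finsupp.mapDomain e₁ c (e₁ (σ ∘ ρ)) = c (σ ∘ ρ) :=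
        Finsupp.mapDomain_apply e₁.injective _ _
      have hσ : e₁ (σ ∘ ρ) = σ := by
        funext j
        simp [e₁, Equiv.arrowCongr]
      rw [hσ] at this
      rw [this, h2, hρ]
      rfl
    have h3 : Finsupp.mapDomain e₀ (boundary 𝕂 V k c) (e₀ (τ ∘ π)) =
        boundary 𝕂 V k c (τ ∘ π) := Finsupp.mapDomain_apply e₀.injective _ _
    have h4 : e₀ (τ ∘ π) = τ := by
      funext j
      simp [e₀, Equiv.arrowCongr]
    have h5 : Finsupp.mapDomain e₀ (boundary 𝕂 V k c) = boundary 𝕂 V k (Finsupp.mapDomain e₁ c) := by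
      simp only [boundary, Finsupp.lmapDomain_apply]
      rw [← Finsupp.mapDomain_comp, ← Finsupp.mapDomain_comp]
      refine congrArg (fun g => Finsupp.mapDomain g c) ?_
      funext σ
      have hs : ∀ j : Fin (k + 1), ρ.symm j.succ = (π.symm j).succ := fun j => by
        rw [Equiv.symm_apply_eq]
        simp [ρ]
      funext j
      simp [e₀, e₁, Equiv.arrowCongr, Fin.tail, hs]
    rw [← h3, h4, h5, key, Units.smul_def, map_zsmul, Units.smul_def]
    rfl

theorem boundary_boundary {K : PreAbstractSimplicialComplex V} {k : ℕ}
    {c : (Fin (k + 3) → V) →₀ 𝕂} (hc : c ∈ chains 𝕂 K (k + 2)) :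
    boundary 𝕂 V k (boundary 𝕂 V (k + 1) c) = 0 := by
  obtain ⟨h1, h2⟩ := hc
  have h01 : (0 : Fin (k + 3)) ≠ 1 := by simp
  simp only [boundary, Finsupp.lmapDomain_apply]
  rw [← Finsupp.mapDomain_comp, Finsupp.mapDomain, Finsupp.sum]
  have hsw : ∀ σ, c (σ ∘ Equiv.swap 0 1) = - c σ := fun σ => by
    rw [h2, Equiv.Perm.sign_swap h01]
    simp
  refine Finset.sum_involution (fun σ _ => σ ∘ Equiv.swap (0 : Fin (k + 3)) 1) ?_ ?_ ?_ ?_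
  · intro σ _
    have ht : Fin.tail (Fin.tail (σ ∘ Equiv.swap (0 : Fin (k + 3)) 1)) = Fin.tail (Fin.tail σ) := by
      funext j
      have : Equiv.swap (0 : Fin (k + 3)) 1 j.succ.succ = j.succ.succ :=
        Equiv.swap_apply_of_ne_of_ne (Fin.succ_ne_zero _)
          (by rw [← Fin.succ_zero_eq_one]; exact fun h => Fin.succ_ne_zero _ (Fin.succ_injective _ h))
      simp [Fin.tail, this]
    simp only [Function.comp_apply, ht, hsw]
    rw [← Finsupp.single_add]
    simp
  · intro σ hσ _ h
    have := congrFun h 0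
    simp only [Function.comp_apply, Equiv.swap_apply_left] at this
    exact h01 ((h1 σ (Finsupp.mem_support_iff.1 hσ)).1 this).symm
  · intro σ hσ
    rw [Finsupp.mem_support_iff, hsw, neg_ne_zero]
    exact Finsupp.mem_support_iff.1 hσ
  · intro σ _
    funext j
    simp

variable (𝕂)

/-- The `k`-cycles `Z_k(K; 𝕂)` (all `0`-chains are cycles). -/
noncomputable def cycles (K : PreAbstractSimplicialComplex V) :
    (k : ℕ) → Submodule 𝕂 ((Fin (k + 1) → V) →₀ 𝕂)
  | 0 => chains 𝕂 K 0
  | k + 1 => chains 𝕂 K (k + 1) ⊓ LinearMap.ker (boundary 𝕂 V k)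

/-- The `k`-boundaries `B_k(K; 𝕂)`. -/
noncomputable def boundaries (K : PreAbstractSimplicialComplex V) (k : ℕ) :
    Submodule 𝕂 ((Fin (k + 1) → V) →₀ 𝕂) :=
  (chains 𝕂 K (k + 1)).map (boundary 𝕂 V k)

theorem boundaries_le_cycles (K : PreAbstractSimplicialComplex V) (k : ℕ) :
    boundaries 𝕂 K k ≤ cycles 𝕂 K k := by
  rintro _ ⟨c, hc, rfl⟩
  cases k with
  | zero => exact boundary_mem_chains hc
  | succ k => exact ⟨boundary_mem_chains hc, boundary_boundary hc⟩

/-- The simplicial homology `H_k(K; 𝕂) = Z_k(K; 𝕂) / B_k(K; 𝕂)`. -/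
abbrev Homology (K : PreAbstractSimplicialComplex V) (k : ℕ) : Type _ :=
  Subquotient (cycles 𝕂 K k) (boundaries 𝕂 K k)

end Homology

/-! ### Čech complexes -/

section Cech

variable {d : ℕ}

/-- The Čech complex `Čech_r(P)`: the nonempty finite `Q ⊆ P` such that the closed balls of
radius `r` centred at the points of `Q` have a common point. -/
def cech (r : ℝ) (P : Set (EuclideanSpace ℝ (Fin d))) :
    PreAbstractSimplicialComplex (EuclideanSpace ℝ (Fin d)) where
  faces := {Q | Q.Nonempty ∧ (Q : Set (EuclideanSpace ℝ (Fin d))) ⊆ P ∧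
    (⋂ x ∈ Q, Metric.closedBall x r).Nonempty}
  isRelLowerSet_faces := by
    rintro Q ⟨hQ, hQP, y, hy⟩
    refine ⟨hQ, fun Q' hQ' hne => ⟨hne, fun x hx => hQP (hQ' hx), y, ?_⟩⟩
    simp only [Set.mem_iInter] at hy ⊢
    exact fun x hx => hy x (hQ' hx)

/-- The Betti number `β_k(P, r) = rank H_k(Čech_r(P); 𝕂)`. -/
noncomputable def betti (𝕂 : Type*) [Field 𝕂] (k : ℕ) (P : Set (EuclideanSpace ℝ (Fin d)))
    (r : ℝ) : ℕ :=
  Module.finrank 𝕂 (Homology 𝕂 (cech r P) k)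

/-- `P` forms a `ϑ`-persistent `k`-cycle: for some `r > 0` there is a `k`-cycle of `Čech_r(P)`
that is not a boundary in `Čech_{ϑ r}(P)`. -/
def FormsPersistentCycle (𝕂 : Type*) [Field 𝕂] (ϑ : ℝ) (k : ℕ)
    (P : Set (EuclideanSpace ℝ (Fin d))) : Prop :=
  ∃ r : ℝ, 0 < r ∧ ∃ γ ∈ cycles 𝕂 (cech r P) k, γ ∉ boundaries 𝕂 (cech (ϑ * r) P) k

/-- `m` is `m(ϑ, k)`, the least number of points of `ℝ^d` forming a `ϑ`-persistent `k`-cycle. -/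
def IsMinVertices (𝕂 : Type*) [Field 𝕂] (d : ℕ) (ϑ : ℝ) (k m : ℕ) : Prop :=
  IsLeast {p : ℕ | ∃ P : Finset (EuclideanSpace ℝ (Fin d)), P.card = p ∧
    FormsPersistentCycle 𝕂 ϑ k (P : Set (EuclideanSpace ℝ (Fin d)))} m

end Cech

/-! ### Poisson processes -/

/-- `f` is a bounded probability density function on `ℝ^d`. -/
structure IsBoundedDensity {d : ℕ} (f : EuclideanSpace ℝ (Fin d) → ℝ) : Prop where
  measurable : Measurable f
  nonneg : ∀ x, 0 ≤ f x
  bounded : ∃ C, ∀ x, f x ≤ C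
  integral_eq_one : ∫ x, f x = 1

/-- The random set `P` is a Poisson process on `ℝ^d` with intensity function `lam`: the number of
points in a Borel set `A` is a random variable with values in `ℕ ∪ {∞}`, it is Poisson distributed
with parameter `∫_A lam` if this is finite, and the numbers of points in pairwise disjoint Borel
sets are mutually independent. -/
structure IsPoissonProcess {d : ℕ} {Ω : Type*} [MeasurableSpace Ω] (μ : Measure Ω)
    (P : Ω → Set (EuclideanSpace ℝ (Fin d))) (lam : EuclideanSpace ℝ (Fin d) → ℝ) : Prop where
  measurable_count : ∀ A, MeasurableSet A → Measurable fun ω => (P ω ∩ A).encard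
  map_count : ∀ A, MeasurableSet A → ∫⁻ x in A, ENNReal.ofReal (lam x) ≠ ⊤ →
    μ.map (fun ω => (P ω ∩ A).encard) =
      (poissonMeasure (∫⁻ x in A, ENNReal.ofReal (lam x)).toNNReal).map (Nat.cast : ℕ → ℕ∞)
  indep_count : ∀ (m : ℕ) (A : Fin m → Set (EuclideanSpace ℝ (Fin d))),
    (∀ i, MeasurableSet (A i)) → Pairwise (fun i j => Disjoint (A i) (A j)) →
    iIndepFun (fun i ω => (P ω ∩ A i).encard) μ

end RandomCech

/-! The count of `k + 2` points governs everything. A simplex in the support of a nonzero `k`-cycle,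
`k ≥ 1`, shares a facet with another support simplex, so a cycle involves at least `k + 2` points
(`exists_extra_vertex`). Conversely, `k + 2` points suffice if all but any one of them lie in a
closed ball of radius `r` but all of them do not: the boundary of this empty simplex is a cycle that
bounds nothing (`exists_robust_empty_simplex`). This gives `m(1, k) = k + 2`.

Upper bound: the Betti number is at most the number of ordered `(k + 2)`-tuples of distinct points
lying in a common neighbourhood of grid cubes of side `r` (`betti_le_tsum`). For a Poisson process
the expected number of such tuples in a set is the `(k + 2)`-nd power of its mass. Each mass is `O(n
r ^ d)` since the density is bounded, and the masses add up to `O(n)`, so the sum is `O(n (n r ^ d)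
^ (k + 1))`.

Lower bound: empty simplices survive small perturbations, and disjoint isolated ones give
independent homology classes (`card_le_betti`). By Lebesgue differentiation and a packing argument
there are of order `r ^ (-d)` separated centres where the density is not too small. By independence
of counts, each carries an isolated empty simplex with probability at least of order `(n r ^ d) ^ (k
+ 2)`, and the product has the same order as the upper bound.

Integrability also needs measurability, although only point counts are assumed measurable. The Betti
number is therefore written as a limit of functions of the set of occupied grid cells
(`eventually_betti_grid_eq`, `aemeasurable_betti`). -/

namespace RandomCech

/-! ### Supports of cycles and dimension bounds for homology -/

section HomologyLemmas

variable {𝕂 : Type*} [Field 𝕂] {V : Type*}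

theorem boundary_apply [DecidableEq V] {k : ℕ} (c : (Fin (k + 2) → V) →₀ 𝕂)
    (ρ : Fin (k + 1) → V) :
    boundary 𝕂 V k c ρ = ∑ τ ∈ c.support.filter (fun τ => Fin.tail τ = ρ), c τ := by
  rw [boundary, Finsupp.lmapDomain_apply, Finsupp.mapDomain, Finsupp.sum, Finsupp.finsetSum_apply,
    Finset.sum_filter]
  refine Finset.sum_congr rfl fun τ _ => ?_
  rw [Finsupp.single_apply]

/-- Every simplex in the support of a cycle shares a facet with another simplex of the support. -/
theorem exists_extra_vertex {K : PreAbstractSimplicialComplex V} {k : ℕ}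
    {c : (Fin (k + 2) → V) →₀ 𝕂} (hc : c ∈ cycles 𝕂 K (k + 1)) {σ : Fin (k + 2) → V}
    (hσ : c σ ≠ 0) :
    ∃ v, v ∉ Set.range σ ∧ c (Fin.cons v (Fin.tail σ) : Fin (k + 2) → V) ≠ 0 := by
  classical
  obtain ⟨⟨h1, -⟩, h2⟩ := hc
  by_contra! hcon
  -- This coefficient sums `c` over all ways of adding a zeroth vertex to `Fin.tail σ`. Vertices
  -- outside `σ` are excluded by `hcon` and repeated vertices by injectivity, so only `c σ` is left.
  have hz : boundary 𝕂 V k c (Fin.tail σ) = 0 := by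
    rw [LinearMap.mem_ker.1 h2]; rfl
  rw [boundary_apply, Finset.sum_eq_single σ] at hz
  · exact hσ hz
  · intro τ hτ hne
    rw [Finset.mem_filter, Finsupp.mem_support_iff] at hτ
    exfalso
    have hτ' : (Fin.cons (τ 0) (Fin.tail σ) : Fin (k + 2) → V) = τ := by
      rw [← hτ.2, Fin.cons_self_tail]
    refine hτ.1 ?_
    rw [← hτ']
    refine hcon (τ 0) ?_
    rintro ⟨j, hj⟩
    induction j using Fin.cases with
    | zero =>
      apply hne
      rw [← hτ', ← hj, Fin.cons_self_tail]
    | succ j =>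
      have h3 : τ j.succ = τ 0 := by
        rw [← hj]; exact congrFun hτ.2 j
      exact Fin.succ_ne_zero j ((h1 τ hτ.1).1 h3)
  · intro h
    refine (h ?_).elim
    rw [Finset.mem_filter, Finsupp.mem_support_iff]
    exact ⟨hσ, rfl⟩

theorem orientedSimplex_apply [DecidableEq V] {k : ℕ} (σ ρ : Fin (k + 1) → V) :
    orientedSimplex 𝕂 σ ρ =
      ∑ π : Equiv.Perm (Fin (k + 1)), if σ ∘ π = ρ then ((Equiv.Perm.sign π : ℤ) : 𝕂) else 0 := by
  rw [orientedSimplex, Finsupp.finsetSum_apply]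
  refine Finset.sum_congr rfl fun π _ => ?_
  rw [Units.smul_def, Finsupp.smul_apply, Finsupp.single_apply]
  split_ifs <;> simp

theorem exists_perm_of_orientedSimplex_apply_ne_zero {k : ℕ} {σ ρ : Fin (k + 1) → V}
    (h : orientedSimplex 𝕂 σ ρ ≠ 0) : ∃ π : Equiv.Perm (Fin (k + 1)), σ ∘ π = ρ := by
  classical
  rw [orientedSimplex_apply] at h
  obtain ⟨π, -, hπ⟩ := Finset.exists_ne_zero_of_sum_ne_zero h
  exact ⟨π, by by_contra h'; simp [h'] at hπ⟩

theorem orientedSimplex_mem_chains {K : PreAbstractSimplicialComplex V} {k : ℕ}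
    {σ : Fin (k + 1) → V} (hσ : Function.Injective σ)
    (hK : ∃ s ∈ K.faces, (s : Set V) = Set.range σ) : orientedSimplex 𝕂 σ ∈ chains 𝕂 K k := by
  classical
  refine ⟨fun ρ hρ => ?_, fun π ρ => ?_⟩
  · obtain ⟨π, rfl⟩ := exists_perm_of_orientedSimplex_apply_ne_zero hρ
    refine ⟨hσ.comp π.injective, ?_⟩
    rwa [Set.range_comp, π.surjective.range_eq, Set.image_univ]
  · rw [orientedSimplex_apply, orientedSimplex_apply, Finset.smul_sum,
      ← Equiv.sum_comp (Equiv.mulRight π)]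
    refine Finset.sum_congr rfl fun π' _ => ?_
    have : σ ∘ (π' * π : Equiv.Perm _) = ρ ∘ π ↔ σ ∘ π' = ρ := by
      rw [Equiv.Perm.coe_mul, ← Function.comp_assoc]
      exact ⟨fun h => by simpa [Function.comp_assoc] using congrArg (· ∘ π.symm) h,
        fun h => by rw [h]⟩
    simp only [Equiv.coe_mulRight, this]
    split_ifs
    · rw [Units.smul_def, zsmul_eq_mul, ← Int.cast_mul, ← Units.val_mul, Equiv.Perm.sign_mul,
        mul_comm]
    · simp

/-- The complex of all nonempty finite sets. -/
def fullComplex (V : Type*) : PreAbstractSimplicialComplex V where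
  faces := {s | s.Nonempty}
  isRelLowerSet_faces := fun _ hs => ⟨hs, fun _ _ h => h⟩

/-- The boundary of a simplex is a cycle of any complex that contains its facets. -/
theorem boundary_orientedSimplex_mem_cycles {K : PreAbstractSimplicialComplex V} {k : ℕ}
    {τ : Fin (k + 2) → V} (hτ : Function.Injective τ)
    (hK : ∀ j : Fin (k + 2), ∃ s ∈ K.faces, (s : Set V) = Set.range (τ ∘ j.succAbove)) :
    boundary 𝕂 V k (orientedSimplex 𝕂 τ) ∈ cycles 𝕂 K k := by
  classical
  -- `τ` itself need not span a face of `K`. In the full complex it does, which yields alternation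
  -- and `∂∂ = 0`; only the support must then be checked in `K`.
  have h0 : orientedSimplex 𝕂 τ ∈ chains 𝕂 (fullComplex V) (k + 1) :=
    orientedSimplex_mem_chains hτ ⟨Finset.univ.image τ,
      ⟨τ 0, Finset.mem_image_of_mem _ (Finset.mem_univ _)⟩, by simp⟩
  have h1 : boundary 𝕂 V k (orientedSimplex 𝕂 τ) ∈ chains 𝕂 K k := by
    refine ⟨fun σ hσ => ⟨((boundary_mem_chains h0).1 σ hσ).1, ?_⟩, (boundary_mem_chains h0).2⟩
    rw [boundary_orientedSimplex, Finsupp.finsetSum_apply] at hσ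
    obtain ⟨j, -, hj⟩ := Finset.exists_ne_zero_of_sum_ne_zero hσ
    rw [Finsupp.smul_apply] at hj
    obtain ⟨π, rfl⟩ := exists_perm_of_orientedSimplex_apply_ne_zero (right_ne_zero_of_smul hj)
    rw [Set.range_comp _ π, π.surjective.range_eq, Set.image_univ]
    exact hK j
  cases k with
  | zero => exact h1
  | succ k => exact ⟨h1, boundary_boundary h0⟩

/-- Only the identity permutation preserves the tail of an injective tuple, so a single term
contributes and the coefficient is nonzero in every characteristic. -/
theorem boundary_orientedSimplex_apply_tail {k : ℕ} {τ : Fin (k + 2) → V}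
    (hτ : Function.Injective τ) :
    boundary 𝕂 V k (orientedSimplex 𝕂 τ) (Fin.tail τ) = 1 := by
  classical
  have key : ∀ π : Equiv.Perm (Fin (k + 2)), Fin.tail (τ ∘ π) = Fin.tail τ → π = 1 := by
    intro π h
    have hs : ∀ j : Fin (k + 1), π j.succ = j.succ := fun j => hτ (congrFun h j)
    ext j
    induction j using Fin.cases with
    | succ j => simp [hs]
    | zero =>
      rcases Fin.eq_zero_or_eq_succ (π 0) with h0 | ⟨j, h0⟩
      · simp [h0]
      · have := π.injective (h0.trans (hs j).symm)
        exact absurd this.symm (Fin.succ_ne_zero j)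
  rw [orientedSimplex, map_sum, Finsupp.finsetSum_apply, Finset.sum_eq_single 1]
  · simp [boundary]
  · intro π _ hπ
    rw [Units.smul_def, map_zsmul, boundary, Finsupp.lmapDomain_apply, Finsupp.mapDomain_single,
      Finsupp.smul_apply, Finsupp.single_apply, if_neg fun h => hπ (key π h), smul_zero]
  · simp

theorem chains_le_supported {K : PreAbstractSimplicialComplex V} {A : Set V}
    (hA : ∀ s ∈ K.faces, (s : Set V) ⊆ A) (k : ℕ) :
    chains 𝕂 K k ≤ Finsupp.supported 𝕂 𝕂 {σ : Fin (k + 1) → V | ∀ i, σ i ∈ A} := by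
  intro c hc
  rw [Finsupp.mem_supported]
  intro σ hσ i
  obtain ⟨-, s, hs, hr⟩ := hc.1 σ (Finsupp.mem_support_iff.1 hσ)
  exact hA s hs (hr ▸ ⟨i, rfl⟩)

theorem finite_supported {α : Type*} {T : Set α} (hT : T.Finite) :
    Module.Finite 𝕂 (Finsupp.supported 𝕂 𝕂 T) := by
  have := hT.to_subtype
  exact Module.Finite.equiv (Finsupp.supportedEquivFinsupp (M := 𝕂) (R := 𝕂) T).symm

theorem finrank_supported {α : Type*} {T : Set α} (hT : T.Finite) :
    Module.finrank 𝕂 (Finsupp.supported 𝕂 𝕂 T) = T.ncard := by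
  have := hT.fintype
  rw [(Finsupp.supportedEquivFinsupp (M := 𝕂) (R := 𝕂) T).finrank_eq, Module.finrank_finsupp_self,
    Set.ncard_eq_toFinset_card', Set.toFinset_card]

theorem cycles_le_chains (K : PreAbstractSimplicialComplex V) (k : ℕ) :
    cycles 𝕂 K k ≤ chains 𝕂 K k := by
  cases k with
  | zero => exact le_rfl
  | succ k => exact inf_le_left

theorem finite_cycles {K : PreAbstractSimplicialComplex V} {A : Set V} (hfin : A.Finite)
    (hA : ∀ s ∈ K.faces, (s : Set V) ⊆ A) (k : ℕ) : Module.Finite 𝕂 (cycles 𝕂 K k) := by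
  have hT : {σ : Fin (k + 1) → V | ∀ i, σ i ∈ A}.Finite := Set.Finite.pi' fun _ => hfin
  have := finite_supported (𝕂 := 𝕂) hT
  exact Submodule.finiteDimensional_of_le
    ((cycles_le_chains K k).trans (chains_le_supported hA k))

/-- Passing to the quotient by boundaries only lowers the dimension. Counting ordered simplices
ignores the alternation, which costs at most a constant factor. -/
theorem finrank_homology_le {K : PreAbstractSimplicialComplex V} {k : ℕ}
    {T : Set (Fin (k + 1) → V)} (hT : T.Finite)
    (h : ∀ c ∈ cycles 𝕂 K k, ∀ σ, c σ ≠ 0 → σ ∈ T) :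
    Module.finrank 𝕂 (Homology 𝕂 K k) ≤ T.ncard := by
  have := finite_supported (𝕂 := 𝕂) hT
  have hle : cycles 𝕂 K k ≤ Finsupp.supported 𝕂 𝕂 T := fun c hc =>
    (Finsupp.mem_supported _ _).2 fun σ hσ => h c hc σ (Finsupp.mem_support_iff.1 hσ)
  have := Submodule.finiteDimensional_of_le hle
  rw [← finrank_supported (𝕂 := 𝕂) hT]
  exact (Submodule.finrank_quotient_le _).trans (Submodule.finrank_mono hle)

/-- A `(k + 1)`-simplex with facet `Fin.tail τ` would meet the `k + 2` vertices of `τ`, hence be a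
proper subset of them, yet it has `k + 2` vertices itself. -/
theorem eq_zero_of_mem_boundaries {K : PreAbstractSimplicialComplex V} {k : ℕ}
    {c : (Fin (k + 1) → V) →₀ 𝕂} (hc : c ∈ boundaries 𝕂 K k) {τ : Fin (k + 2) → V}
    (hτ : Function.Injective τ)
    (hiso : ∀ s ∈ K.faces, (∃ x ∈ s, x ∈ Set.range τ) → (s : Set V) ⊂ Set.range τ) :
    c (Fin.tail τ) = 0 := by
  classical
  obtain ⟨b, hb, rfl⟩ := hc
  rw [boundary_apply]
  refine Finset.sum_eq_zero fun ρ hρ => ?_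
  rw [Finset.mem_filter] at hρ
  by_contra h
  obtain ⟨hinj, s, hs, hsr⟩ := hb.1 ρ h
  have h1 := hiso s hs ⟨ρ (Fin.succ 0), Finset.mem_coe.1 (hsr.symm ▸ ⟨_, rfl⟩), ⟨Fin.succ 0, (congrFun hρ.2 0).symm⟩⟩
  rw [hsr] at h1
  have h2 := Set.ncard_lt_ncard h1 (Set.finite_range τ)
  rw [← Set.image_univ, ← Set.image_univ, Set.ncard_image_of_injective _ hinj,
    Set.ncard_image_of_injective _ hτ] at h2
  exact lt_irrefl _ h2

/-- Disjoint isolated boundaries of simplices bound the Betti number from below. -/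
theorem card_le_finrank_homology {K : PreAbstractSimplicialComplex V} {A : Set V} (hfin : A.Finite)
    (hA : ∀ s ∈ K.faces, (s : Set V) ⊆ A) {k : ℕ} {ι : Type*} [Fintype ι]
    (τ : ι → Fin (k + 2) → V) (hinj : ∀ i, Function.Injective (τ i))
    (hdisj : ∀ i j, i ≠ j → Disjoint (Set.range (τ i)) (Set.range (τ j)))
    (hfacet : ∀ i, ∀ j : Fin (k + 2), ∃ s ∈ K.faces, (s : Set V) = Set.range (τ i ∘ j.succAbove))
    (hiso : ∀ i, ∀ s ∈ K.faces, (∃ x ∈ s, x ∈ Set.range (τ i)) → (s : Set V) ⊂ Set.range (τ i)) :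
    Fintype.card ι ≤ Module.finrank 𝕂 (Homology 𝕂 K k) := by
  classical
  have := finite_cycles (𝕂 := 𝕂) hfin hA k
  -- Evaluation at one facet of each `τ i` kills boundaries, so it descends to homology. On the
  -- classes of the `∂ τ i` it gives the identity matrix and is therefore onto.
  let ev : ((Fin (k + 1) → V) →₀ 𝕂) →ₗ[𝕂] (ι → 𝕂) :=
    LinearMap.pi fun i => Finsupp.lapply (Fin.tail (τ i))
  have hle : (boundaries 𝕂 K k).submoduleOf (cycles 𝕂 K k) ≤
      LinearMap.ker (ev.comp (cycles 𝕂 K k).subtype) := by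
    rintro ⟨c, hc⟩ hcb
    rw [LinearMap.mem_ker]
    funext i
    exact eq_zero_of_mem_boundaries (Submodule.mem_comap.1 hcb) (hinj i) (hiso i)
  let Φ : Homology 𝕂 K k →ₗ[𝕂] (ι → 𝕂) := Submodule.liftQ _ _ hle
  have hγ : ∀ i, boundary 𝕂 V k (orientedSimplex 𝕂 (τ i)) ∈ cycles 𝕂 K k := fun i =>
    boundary_orientedSimplex_mem_cycles (hinj i) (hfacet i)
  have hev : ∀ i j, boundary 𝕂 V k (orientedSimplex 𝕂 (τ i)) (Fin.tail (τ j)) =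
      if i = j then 1 else 0 := by
    intro i j
    split_ifs with h
    · subst h; exact boundary_orientedSimplex_apply_tail (hinj i)
    · by_contra hne
      rw [boundary_orientedSimplex, Finsupp.finsetSum_apply] at hne
      obtain ⟨l, -, hl⟩ := Finset.exists_ne_zero_of_sum_ne_zero hne
      rw [Finsupp.smul_apply] at hl
      obtain ⟨π, hπ⟩ := exists_perm_of_orientedSimplex_apply_ne_zero (right_ne_zero_of_smul hl)
      refine Set.disjoint_left.1 (hdisj i j h) ⟨l.succAbove (π 0), congrFun hπ 0⟩ ⟨Fin.succ 0, rfl⟩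
  have hsurj : Function.Surjective Φ := by
    intro a
    refine ⟨Submodule.Quotient.mk (∑ i, a i • ⟨_, hγ i⟩), ?_⟩
    change (Submodule.liftQ _ _ hle) _ = a
    rw [Submodule.liftQ_apply]
    funext j
    simp [ev, hev]
  have := LinearMap.finrank_le_finrank_of_surjective hsurj
  rwa [Module.finrank_fintype_fun_eq_card] at this

/-! ### Invariance of homology under renaming vertices -/

section Relabel

variable {K L : PreAbstractSimplicialComplex V} (e : V ≃ V)

/-- The relabelling of vertices on functions on ordered simplices. -/
noncomputable def relabel (𝕂 : Type*) [Field 𝕂] (e : V ≃ V) (k : ℕ) :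
    ((Fin (k + 1) → V) →₀ 𝕂) ≃ₗ[𝕂] ((Fin (k + 1) → V) →₀ 𝕂) :=
  Finsupp.domLCongr ((Equiv.refl (Fin (k + 1))).arrowCongr e)

theorem relabel_apply (k : ℕ) (c : (Fin (k + 1) → V) →₀ 𝕂) (σ : Fin (k + 1) → V) :
    relabel 𝕂 e k c σ = c (e.symm ∘ σ) := by
  simp only [relabel, Finsupp.domLCongr_apply, Finsupp.domCongr_apply, Finsupp.equivMapDomain_apply]
  rfl

theorem boundary_relabel (k : ℕ) (c : (Fin (k + 2) → V) →₀ 𝕂) :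
    boundary 𝕂 V k (relabel 𝕂 e (k + 1) c) = relabel 𝕂 e k (boundary 𝕂 V k c) := by
  simp only [relabel, Finsupp.domLCongr_apply, Finsupp.domCongr_apply,
    Finsupp.equivMapDomain_eq_mapDomain, boundary, Finsupp.lmapDomain_apply,
    ← Finsupp.mapDomain_comp]
  rfl

variable {e}

theorem relabel_mem_chains (he : ∀ s ∈ K.faces, s.map e.toEmbedding ∈ L.faces) {k : ℕ}
    {c : (Fin (k + 1) → V) →₀ 𝕂} (hc : c ∈ chains 𝕂 K k) : relabel 𝕂 e k c ∈ chains 𝕂 L k := by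
  refine ⟨fun σ hσ => ?_, fun π σ => ?_⟩
  · rw [relabel_apply] at hσ
    obtain ⟨hi, s, hs, hr⟩ := hc.1 _ hσ
    refine ⟨fun a b h => hi (by simp [h]), _, he s hs, ?_⟩
    rw [Finset.coe_map, hr, ← Set.range_comp]
    congr 1
    funext i
    simp
  · rw [relabel_apply, relabel_apply, ← Function.comp_assoc, hc.2]

theorem map_relabel_chains (he : ∀ s ∈ K.faces, s.map e.toEmbedding ∈ L.faces)
    (he' : ∀ s ∈ L.faces, s.map e.symm.toEmbedding ∈ K.faces) (k : ℕ) :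
    (chains 𝕂 K k).map (relabel 𝕂 e k : _ →ₗ[𝕂] _) = chains 𝕂 L k := by
  refine le_antisymm ?_ fun c hc => ⟨relabel 𝕂 e.symm k c, relabel_mem_chains he' hc, ?_⟩
  · rintro _ ⟨c, hc, rfl⟩
    exact relabel_mem_chains he hc
  · ext σ
    simp only [LinearEquiv.coe_coe, relabel_apply]
    congr 1
    funext i
    simp

theorem map_relabel_cycles (he : ∀ s ∈ K.faces, s.map e.toEmbedding ∈ L.faces)
    (he' : ∀ s ∈ L.faces, s.map e.symm.toEmbedding ∈ K.faces) (k : ℕ) :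
    (cycles 𝕂 K k).map (relabel 𝕂 e k : _ →ₗ[𝕂] _) = cycles 𝕂 L k := by
  cases k with
  | zero => exact map_relabel_chains he he' 0
  | succ k =>
    have h : ∀ c, boundary 𝕂 V k (relabel 𝕂 e (k + 1) c) = 0 ↔ boundary 𝕂 V k c = 0 := fun c => by
      rw [boundary_relabel, LinearEquiv.map_eq_zero_iff]
    refine le_antisymm ?_ ?_
    · rintro _ ⟨c, ⟨hc, hc'⟩, rfl⟩
      exact ⟨relabel_mem_chains he hc, (h c).2 hc'⟩
    · rintro c ⟨hc, hc'⟩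
      rw [← map_relabel_chains he he'] at hc
      obtain ⟨b, hb, rfl⟩ := hc
      exact ⟨b, ⟨hb, (h b).1 hc'⟩, rfl⟩

theorem map_relabel_boundaries (he : ∀ s ∈ K.faces, s.map e.toEmbedding ∈ L.faces)
    (he' : ∀ s ∈ L.faces, s.map e.symm.toEmbedding ∈ K.faces) (k : ℕ) :
    (boundaries 𝕂 K k).map (relabel 𝕂 e k : _ →ₗ[𝕂] _) = boundaries 𝕂 L k := by
  rw [boundaries, boundaries, ← map_relabel_chains he he', ← Submodule.map_comp,
    ← Submodule.map_comp]
  congr 1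
  exact LinearMap.ext fun c => (boundary_relabel e k c).symm

/-- Homology does not depend on the names of the vertices. -/
theorem finrank_homology_congr (he : ∀ s ∈ K.faces, s.map e.toEmbedding ∈ L.faces)
    (he' : ∀ s ∈ L.faces, s.map e.symm.toEmbedding ∈ K.faces) (k : ℕ) :
    Module.finrank 𝕂 (Homology 𝕂 K k) = Module.finrank 𝕂 (Homology 𝕂 L k) := by
  have hZ := map_relabel_cycles (𝕂 := 𝕂) he he' k
  have hB := map_relabel_boundaries (𝕂 := 𝕂) he he' k
  refine LinearEquiv.finrank_eq (Submodule.Quotient.equiv _ _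
    ((relabel 𝕂 e k).ofSubmodules _ _ hZ) ?_)
  ext ⟨c, hc⟩
  simp only [Submodule.mem_map, Submodule.submoduleOf, Submodule.mem_comap]
  constructor
  · rintro ⟨⟨b, hb⟩, hb', h⟩
    change c ∈ boundaries 𝕂 L k
    rw [← hB]
    exact ⟨b, hb', congrArg Subtype.val h⟩
  · intro h
    change c ∈ boundaries 𝕂 L k at h
    rw [← hB] at h
    obtain ⟨b, hb, rfl⟩ := h
    exact ⟨⟨b, boundaries_le_cycles 𝕂 K k hb⟩, hb, rfl⟩

end Relabel

end HomologyLemmas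

/-! ### Empty simplices and the minimal number of vertices -/

section EmptySimplices

variable {d : ℕ}

/-- In `‖u - t w‖² = 1 - 2 t ⟨u, w⟩ + t² ‖w‖²` the linear term wins for small `t > 0`. Lying in an
open unit ball thus becomes a sign condition on inner products. -/
theorem dist_lt_one_of_inner_pos {E : Type*} [NormedAddCommGroup E] [InnerProductSpace ℝ E]
    {u w : E} (hu : ‖u‖ = 1) (h : 0 < inner ℝ u w) :
    ∀ᶠ t : ℝ in 𝓝[>] 0, dist u (t • w) < 1 := by
  have h1 : Tendsto (fun t : ℝ => t * ‖w‖ ^ 2) (𝓝[>] 0) (𝓝 (0 * ‖w‖ ^ 2)) :=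
    (tendsto_id.mul_const _).mono_left nhdsWithin_le_nhds
  rw [zero_mul] at h1
  filter_upwards [h1.eventually_lt_const h, self_mem_nhdsWithin] with t ht ht0
  rw [Set.mem_Ioi] at ht0
  rw [dist_eq_norm, ← sq_lt_one_iff₀ (norm_nonneg _), norm_sub_sq_real, hu, inner_smul_right,
    norm_smul, Real.norm_of_nonneg ht0.le, mul_pow]
  nlinarith [mul_lt_mul_of_pos_left ht ht0, mul_pos ht0 h]

/-- There are `m + 1` unit vectors in `ℝ^d` that lie in no open unit ball, although all but any one
of them do. -/
theorem exists_unit_simplex {m : ℕ} (hm : 0 < m) (hmd : m ≤ d) :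
    ∃ u : Fin (m + 1) → EuclideanSpace ℝ (Fin d),
      (∀ j, ∃ y, ∀ i, i ≠ j → dist (u i) y < 1) ∧ ∀ y, ∃ i, 1 ≤ dist (u i) y := by
  let e : Fin m → EuclideanSpace ℝ (Fin d) := fun i =>
    EuclideanSpace.basisFun (Fin d) ℝ (Fin.castLE hmd i)
  have he : Orthonormal ℝ e :=
    (EuclideanSpace.basisFun (Fin d) ℝ).orthonormal.comp _ (Fin.castLE_injective hmd)
  let S := ∑ i, e i
  have heS : ∀ i, inner ℝ (e i) S = 1 := fun i => by
    simp [S, inner_sum, orthonormal_iff_ite.1 he]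
  have hSe : ∀ i, inner ℝ S (e i) = 1 := fun i => by rw [real_inner_comm, heS]
  have hSS : inner ℝ S S = (m : ℝ) := by
    conv_lhs => rw [show S = ∑ i, e i from rfl, sum_inner]
    simp only [← show S = ∑ i, e i from rfl, heS]
    simp
  have hm0 : (0 : ℝ) < m := by exact_mod_cast hm
  have hS : ‖S‖ ≠ 0 := by
    intro h
    rw [real_inner_self_eq_norm_sq, h] at hSS
    norm_num at hSS
    exact hm0.ne hSS
  have hS0 : 0 < ‖S‖ := lt_of_le_of_ne (norm_nonneg _) hS.symm
  -- The last direction opposes the sum of the others, so no vector has positive inner product with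
  -- all of them.
  let u : Fin (m + 1) → EuclideanSpace ℝ (Fin d) := Fin.cons (-(‖S‖⁻¹ • S)) e
  have hu : ∀ i, ‖u i‖ = 1 := by
    intro i
    cases i using Fin.cases with
    | zero => simp [u, norm_smul, hS]
    | succ i => exact he.1 i
  refine ⟨u, fun j => ?_, fun y => ?_⟩
  · obtain ⟨w, hw⟩ : ∃ w, ∀ i, i ≠ j → 0 < inner ℝ (u i) w := by
      cases j using Fin.cases with
      | zero =>
        refine ⟨S, fun i hi => ?_⟩
        obtain ⟨i, rfl⟩ := Fin.exists_succ_eq.2 hi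
        simp [u, heS]
      | succ j =>
        -- The coefficient `m + 1` exceeds `⟨S, S⟩ = m`, which makes the inner product with `S`
        -- equal to `-1`, while `⟨e i, w⟩ = 1` for `i ≠ j`.
        refine ⟨S - ((m : ℝ) + 1) • e j, fun i hi => ?_⟩
        cases i using Fin.cases with
        | zero =>
          simp only [u, Fin.cons_zero, inner_neg_left, inner_smul_left, inner_sub_right,
            inner_smul_right, hSS, hSe]
          have : (0 : ℝ) < ‖S‖⁻¹ := inv_pos.2 hS0
          simp only [map_inv₀, conj_trivial]
          nlinarith
        | succ i =>
          have hij : i ≠ j := fun h => hi (by rw [h])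
          simp [u, inner_sub_right, inner_smul_right, heS, he.2 hij]
    have h1 : ∀ᶠ t : ℝ in 𝓝[>] 0, ∀ i, i ≠ j → dist (u i) (t • w) < 1 := by
      rw [eventually_all]
      intro i
      by_cases hi : i = j
      · simp [hi]
      · filter_upwards [dist_lt_one_of_inner_pos (hu i) (hw i hi)] with t ht _ using ht
    obtain ⟨t, ht⟩ := h1.exists
    exact ⟨t • w, ht⟩
  · by_contra! h
    have h1 : ∀ i, 0 < inner ℝ (u i) y := by
      intro i
      have h2 := h i
      rw [dist_eq_norm, ← sq_lt_one_iff₀ (norm_nonneg _), norm_sub_sq_real, hu] at h2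
      nlinarith [sq_nonneg ‖y‖]
    have h2 : 0 ≤ inner ℝ S y := by
      rw [sum_inner]
      exact Finset.sum_nonneg fun i _ => (h1 i.succ).le
    have h3 := h1 0
    simp only [u, Fin.cons_zero, inner_neg_left, inner_smul_left] at h3
    have : (0 : ℝ) < ‖S‖⁻¹ := inv_pos.2 hS0
    simp only [map_inv₀, conj_trivial] at h3
    nlinarith [mul_nonneg this.le h2]

/-- A robust version of `exists_unit_simplex` at scale `1`. -/
theorem exists_robust_empty_simplex {m : ℕ} (hm : 0 < m) (hmd : m ≤ d) :
    ∃ (v : Fin (m + 1) → EuclideanSpace ℝ (Fin d)) (ε : ℝ), 0 < ε ∧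
      (∀ j, ∃ y, ∀ i, i ≠ j → dist (v i) y ≤ 1 - ε) ∧ ∀ y, ∃ i, 1 + ε < dist (v i) y := by
  obtain ⟨u, h1, h2⟩ := exists_unit_simplex hm hmd
  choose y hy using h1
  obtain ⟨ρ, hρ0, hρ1, hρ⟩ : ∃ ρ : ℝ, 0 < ρ ∧ ρ < 1 ∧ ∀ j i, i ≠ j → dist (u i) (y j) ≤ ρ := by
    have : ∀ᶠ ρ : ℝ in 𝓝[<] 1, ∀ j i, i ≠ j → dist (u i) (y j) ≤ ρ := by
      simp only [eventually_all]
      intro j i hij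
      exact (eventually_gt_nhds (hy j i hij)).filter_mono nhdsWithin_le_nhds |>.mono fun _ => le_of_lt
    obtain ⟨ρ, ⟨h3, h4⟩, h5⟩ := ((this.and self_mem_nhdsWithin).and
      ((eventually_gt_nhds (zero_lt_one' ℝ)).filter_mono nhdsWithin_le_nhds)).exists
    exact ⟨ρ, h5, h4, h3⟩
  -- Dividing by a scale strictly between `ρ` and `1` turns the facet radius `ρ` into something
  -- below `1` and the radius `1`, which is too small for all points, into something above `1`.
  let s := (1 + ρ) / 2
  have hs : 0 < s := by positivity
  have hd : ∀ i z, dist (s⁻¹ • u i) (s⁻¹ • z) = dist (u i) z / s := fun i z => by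
    rw [dist_smul₀, Real.norm_of_nonneg (inv_pos.2 hs).le, inv_mul_eq_div]
  refine ⟨fun i => s⁻¹ • u i, (1 - ρ) / 4, by linarith, fun j => ⟨s⁻¹ • y j, fun i hij => ?_⟩,
    fun z => ?_⟩
  · rw [hd, div_le_iff₀ hs]
    have := hρ j i hij
    simp only [s]
    nlinarith [mul_pos (sub_pos.2 hρ1) (show 0 < 3 - ρ by linarith)]
  · obtain ⟨i, hi⟩ := h2 (s • z)
    refine ⟨i, ?_⟩
    have := hd i (s • z)
    rw [inv_smul_smul₀ hs.ne'] at this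
    rw [this, lt_div_iff₀ hs]
    simp only [s]
    nlinarith [mul_pos (sub_pos.2 hρ1) (show 0 < 3 - ρ by linarith)]

/-- All but any one of the points `w i` lie in a closed ball of radius `r`, but all of them do
not. -/
structure IsEmptySimplex {m : ℕ} (r : ℝ) (w : Fin (m + 1) → EuclideanSpace ℝ (Fin d)) : Prop where
  facet : ∀ j, ∃ y, ∀ i, i ≠ j → dist (w i) y ≤ r
  empty : ∀ y, ∃ i, r < dist (w i) y

/-- If `w a = w b` with `a ≠ b`, a ball containing all points but `w a` would contain `w a` too. -/
theorem IsEmptySimplex.injective {m : ℕ} {r : ℝ} {w : Fin (m + 1) → EuclideanSpace ℝ (Fin d)}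
    (h : IsEmptySimplex r w) : Function.Injective w := by
  intro a b hab
  by_contra hne
  obtain ⟨y, hy⟩ := h.facet a
  obtain ⟨i, hi⟩ := h.empty y
  by_cases hia : i = a
  · subst hia
    rw [hab] at hi
    exact absurd (hy b (Ne.symm hne)) (not_le.2 hi)
  · exact absurd (hy i hia) (not_le.2 hi)

/-- The margin `ε` on both sides absorbs the displacement, by the triangle inequality. Random points
may therefore sit anywhere in the small balls. -/
theorem isEmptySimplex_of_dist_le {m : ℕ} {v : Fin (m + 1) → EuclideanSpace ℝ (Fin d)} {ε : ℝ}
    (h1 : ∀ j, ∃ y, ∀ i, i ≠ j → dist (v i) y ≤ 1 - ε) (h2 : ∀ y, ∃ i, 1 + ε < dist (v i) y)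
    {r : ℝ} (hr : 0 < r) (x : EuclideanSpace ℝ (Fin d))
    {w : Fin (m + 1) → EuclideanSpace ℝ (Fin d)} (hw : ∀ i, dist (w i) (x + r • v i) ≤ ε * r) :
    IsEmptySimplex r w := by
  have hd : ∀ i y, dist (x + r • v i) (x + r • y) = r * dist (v i) y := fun i y => by
    rw [dist_add_left, dist_smul₀, Real.norm_of_nonneg hr.le]
  refine ⟨fun j => ?_, fun y => ?_⟩
  · obtain ⟨y, hy⟩ := h1 j
    refine ⟨x + r • y, fun i hi => ?_⟩
    have := dist_triangle (w i) (x + r • v i) (x + r • y)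
    rw [hd] at this
    nlinarith [hw i, mul_le_mul_of_nonneg_left (hy i hi) hr.le]
  · obtain ⟨i, hi⟩ := h2 (r⁻¹ • (y - x))
    refine ⟨i, ?_⟩
    have h3 := hd i (r⁻¹ • (y - x))
    rw [smul_inv_smul₀ hr.ne', add_sub_cancel] at h3
    have := dist_triangle_left (x + r • v i) y (w i)
    nlinarith [hw i, mul_lt_mul_of_pos_left hi hr]

theorem IsEmptySimplex.facet_mem_cech {m : ℕ} {r : ℝ}
    {w : Fin (m + 2) → EuclideanSpace ℝ (Fin d)} (h : IsEmptySimplex r w)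
    {P : Set (EuclideanSpace ℝ (Fin d))} (hw : ∀ i, w i ∈ P) (j : Fin (m + 2)) :
    ∃ s ∈ (cech r P).faces, (s : Set (EuclideanSpace ℝ (Fin d))) = Set.range (w ∘ j.succAbove) := by
  classical
  obtain ⟨y, hy⟩ := h.facet j
  refine ⟨Finset.univ.image (w ∘ j.succAbove), ⟨⟨_, Finset.mem_image_of_mem _ (Finset.mem_univ 0)⟩,
    ?_, y, ?_⟩, by simp [Function.comp_def]⟩
  · intro x hx
    obtain ⟨i, -, rfl⟩ := Finset.mem_image.1 (Finset.mem_coe.1 hx)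
    exact hw _
  · simp only [Set.mem_iInter]
    intro x hx
    obtain ⟨i, -, rfl⟩ := Finset.mem_image.1 hx
    rw [Metric.mem_closedBall, dist_comm]
    exact hy _ (Fin.succAbove_ne j i)

theorem IsEmptySimplex.ssubset {m : ℕ} {r : ℝ}
    {w : Fin (m + 1) → EuclideanSpace ℝ (Fin d)} (h : IsEmptySimplex r w)
    {P : Set (EuclideanSpace ℝ (Fin d))} {s : Finset (EuclideanSpace ℝ (Fin d))}
    (hs : s ∈ (cech r P).faces) (hsub : (s : Set (EuclideanSpace ℝ (Fin d))) ⊆ Set.range w) :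
    (s : Set (EuclideanSpace ℝ (Fin d))) ⊂ Set.range w := by
  refine hsub.ssubset_of_ne fun heq => ?_
  obtain ⟨-, -, y, hy⟩ := hs
  obtain ⟨i, hi⟩ := h.empty y
  simp only [Set.mem_iInter] at hy
  have := hy (w i) (Finset.mem_coe.1 (heq.symm ▸ ⟨i, rfl⟩))
  rw [Metric.mem_closedBall, dist_comm] at this
  exact absurd this (not_le.2 hi)

theorem cech_faces_subset {r : ℝ} {P : Set (EuclideanSpace ℝ (Fin d))} :
    ∀ s ∈ (cech r P).faces, (s : Set (EuclideanSpace ℝ (Fin d))) ⊆ P := fun _ hs => hs.2.1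

theorem mem_of_cycle_apply_ne_zero {𝕂 : Type*} [Field 𝕂] {k : ℕ} {r : ℝ}
    {P : Set (EuclideanSpace ℝ (Fin d))} {c : (Fin (k + 1) → EuclideanSpace ℝ (Fin d)) →₀ 𝕂}
    (hc : c ∈ cycles 𝕂 (cech r P) k) {σ : Fin (k + 1) → EuclideanSpace ℝ (Fin d)} (hσ : c σ ≠ 0)
    (i : Fin (k + 1)) : σ i ∈ P :=
  (Finsupp.mem_supported _ _).1 (chains_le_supported cech_faces_subset k (cycles_le_chains _ k hc))
    (Finsupp.mem_support_iff.2 hσ) i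

/-- The boundary of an empty simplex attains the value. For minimality, a non-boundary is nonzero,
and a support simplex together with its extra vertex already has `k + 2` points. -/
theorem isMinVertices_one (𝕂 : Type*) [Field 𝕂] {k : ℕ} (hk : 1 ≤ k) (hkd : k + 1 ≤ d) :
    IsMinVertices 𝕂 d 1 k (k + 2) := by
  classical
  obtain ⟨k, rfl⟩ := Nat.exists_eq_add_of_le' hk
  constructor
  · obtain ⟨v, ε, hε, h1, h2⟩ := exists_robust_empty_simplex (Nat.succ_pos _) hkd
    have hv : IsEmptySimplex 1 v :=
      isEmptySimplex_of_dist_le h1 h2 one_pos 0 fun i => by simpa using hε.le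
    refine ⟨Finset.univ.image v, ?_, 1, one_pos, _, boundary_orientedSimplex_mem_cycles hv.injective
      (hv.facet_mem_cech fun i => by simp), fun hb => ?_⟩
    · rw [Finset.card_image_of_injective _ hv.injective, Finset.card_univ, Fintype.card_fin]
    · rw [mul_one] at hb
      have := eq_zero_of_mem_boundaries hb hv.injective fun s hs _ =>
        hv.ssubset hs (by simpa using cech_faces_subset s hs)
      rw [boundary_orientedSimplex_apply_tail hv.injective] at this
      exact one_ne_zero this
  · rintro p ⟨P, rfl, r, hr, γ, hγ, hb⟩
    obtain ⟨σ, hσ⟩ : ∃ σ, γ σ ≠ 0 := by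
      by_contra! h
      have : γ = 0 := Finsupp.ext h
      exact hb (this ▸ Submodule.zero_mem _)
    obtain ⟨v, hv, hv'⟩ := exists_extra_vertex hγ hσ
    have hinj : Function.Injective (Fin.cons v σ : Fin (k + 1 + 2) → _) :=
      Fin.cons_injective_iff.2 ⟨hv, ((cycles_le_chains _ _ hγ).1 σ hσ).1⟩
    have hmem : ∀ i, (Fin.cons v σ : Fin (k + 1 + 2) → _) i ∈ P := by
      intro i
      cases i using Fin.cases with
      | zero => exact mem_of_cycle_apply_ne_zero hγ hv' 0
      | succ i => exact mem_of_cycle_apply_ne_zero hγ hσ i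
    have := Finset.card_le_card_of_injOn (s := Finset.univ) _ (fun i _ => hmem i) hinj.injOn
    simp only [Finset.card_univ, Fintype.card_fin] at this
    omega

end EmptySimplices

/-! ### Discretisation of point sets by grids -/

section Grid

variable {d : ℕ}

theorem dist_le_of_forall_abs_sub_le {x y : EuclideanSpace ℝ (Fin d)} {c : ℝ} (hc : 0 ≤ c)
    (h : ∀ i, |x i - y i| ≤ c) : dist x y ≤ d * c := by
  rw [EuclideanSpace.dist_eq]
  refine Real.sqrt_le_iff.2 ⟨by positivity, ?_⟩
  calc ∑ i, dist (x i) (y i) ^ 2 ≤ ∑ _i : Fin d, c ^ 2 := by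
        refine Finset.sum_le_sum fun i _ => ?_
        rw [Real.dist_eq]
        exact pow_le_pow_left₀ (abs_nonneg _) (h i) 2
    _ = d * c ^ 2 := by simp
    _ ≤ (d * c) ^ 2 := by
        rw [mul_pow]
        refine mul_le_mul_of_nonneg_right ?_ (sq_nonneg c)
        exact_mod_cast Nat.le_self_pow two_ne_zero d

/-- The index of the half-open grid cube of side `s` that contains `x`. -/
noncomputable def cellIndex (s : ℝ) (x : EuclideanSpace ℝ (Fin d)) : Fin d → ℤ := fun i => ⌊x i / s⌋

/-- The corner of the grid cube with index `z`. -/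
noncomputable def cellCorner (s : ℝ) (z : Fin d → ℤ) : EuclideanSpace ℝ (Fin d) :=
  WithLp.toLp 2 fun i => s * z i

theorem measurable_cellIndex (s : ℝ) : Measurable (cellIndex (d := d) s) := by
  refine measurable_pi_lambda _ fun i => Int.measurable_floor.comp ?_
  exact Measurable.div_const (by fun_prop) s

theorem dist_cellCorner_cellIndex_le {s : ℝ} (hs : 0 < s) (x : EuclideanSpace ℝ (Fin d)) :
    dist (cellCorner s (cellIndex s x)) x ≤ d * s := by
  refine dist_le_of_forall_abs_sub_le hs.le fun i => ?_
  have h1 := Int.floor_le (x i / s)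
  have h2 := Int.lt_floor_add_one (x i / s)
  rw [le_div_iff₀ hs] at h1
  rw [div_lt_iff₀ hs] at h2
  simp only [cellCorner, cellIndex]
  rw [abs_le]
  constructor <;> nlinarith

/-- Permutations act transitively on tuples of distinct elements of any finite length. This upgrades
the snapping map, injective only on `P`, to a bijection to which the relabelling of homology
applies. -/
theorem exists_perm_eqOn {V : Type*} {P : Set V} (hP : P.Finite) {φ : V → V}
    (hφ : Set.InjOn φ P) : ∃ e : V ≃ V, Set.EqOn e φ P := by
  have := hP.to_subtype
  have hn := Equiv.Perm.isMultiplyPretransitive V (Nat.card P)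
  let x : Fin (Nat.card P) ↪ V := ⟨fun i => ((Finite.equivFin P).symm i : V),
    Subtype.val_injective.comp (Equiv.injective _)⟩
  let y : Fin (Nat.card P) ↪ V := ⟨fun i => φ ((Finite.equivFin P).symm i : V),
    hφ.injective.comp (Equiv.injective _)⟩
  obtain ⟨g, hg⟩ := hn.exists_smul_eq x y
  refine ⟨g, fun p hp => ?_⟩
  have h : g ((Finite.equivFin P).symm (Finite.equivFin P ⟨p, hp⟩) : V) =
      φ ((Finite.equivFin P).symm (Finite.equivFin P ⟨p, hp⟩) : V) :=
    DFunLike.congr_fun hg (Finite.equivFin P ⟨p, hp⟩)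
  rwa [Equiv.symm_apply_apply] at h

/-- By compactness, the nested intersections for radii decreasing to `r` have a common point. With
closed balls, faces thus do not appear suddenly just above `r`. -/
theorem nonempty_iInter_closedBall_of_forall_add {Q : Finset (EuclideanSpace ℝ (Fin d))}
    (hQ : Q.Nonempty) {r : ℝ} (h : ∀ δ > 0, (⋂ x ∈ Q, Metric.closedBall x (r + δ)).Nonempty) :
    (⋂ x ∈ Q, Metric.closedBall x r).Nonempty := by
  obtain ⟨x₀, hx₀⟩ := hQ
  have hclosed : ∀ n : ℕ, IsClosed (⋂ x ∈ Q, Metric.closedBall x (r + 1 / ((n : ℝ) + 1))) :=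
    fun n => isClosed_biInter fun x _ => Metric.isClosed_closedBall
  have hne := IsCompact.nonempty_iInter_of_sequence_nonempty_isCompact_isClosed
    (fun n : ℕ => ⋂ x ∈ Q, Metric.closedBall x (r + 1 / ((n : ℝ) + 1)))
    (fun n => Set.iInter₂_mono fun x _ => Metric.closedBall_subset_closedBall (by
      have := Nat.one_div_le_one_div (α := ℝ) (Nat.le_succ n)
      push_cast at this ⊢
      linarith))
    (fun n => h _ Nat.one_div_pos_of_nat)
    ((isCompact_closedBall x₀ _).of_isClosed_subset (hclosed 0) (Set.biInter_subset_of_mem hx₀))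
    hclosed
  obtain ⟨y, hy⟩ := hne
  refine ⟨y, ?_⟩
  simp only [Set.mem_iInter, Metric.mem_closedBall] at hy ⊢
  intro x hx
  refine le_of_tendsto_of_tendsto' tendsto_const_nhds
    (by simpa using (tendsto_one_div_add_atTop_nhds_zero_nat (𝕜 := ℝ)).const_add r)
    fun n => hy n x hx

/-- Moving finitely many points to a fine grid, and enlarging the radius accordingly, does not
change the Betti numbers. -/
theorem eventually_betti_grid_eq (𝕂 : Type*) [Field 𝕂] (k : ℕ)
    {P : Set (EuclideanSpace ℝ (Fin d))} (hP : P.Finite) (r : ℝ) :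
    ∀ᶠ s : ℝ in 𝓝[>] 0,
      betti 𝕂 k (cellCorner s '' (cellIndex s '' P)) (r + d * s) = betti 𝕂 k P r := by
  classical
  -- Snapping moves points by at most `d * s`. Enlarging the radius by `d * s` keeps all old faces,
  -- and a face of the snapped set pulls back to one at radius `r + 2 * d * s`, hence at radius `r`
  -- once `s` is small.
  have hsmall : ∀ δ > 0, ∀ᶠ s : ℝ in 𝓝[>] 0, d * s + d * s < δ := by
    intro δ hδ
    have h1 : Tendsto (fun s : ℝ => d * s + d * s) (𝓝[>] 0) (𝓝 (d * 0 + d * 0)) :=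
      (((tendsto_id.const_mul _).add (tendsto_id.const_mul _))).mono_left nhdsWithin_le_nhds
    rw [mul_zero, add_zero] at h1
    exact h1.eventually_lt_const hδ
  have h1 : ∀ᶠ s : ℝ in 𝓝[>] 0, ∀ x ∈ P, ∀ y ∈ P, x ≠ y → d * s + d * s < dist x y := by
    rw [eventually_all_finite hP]
    intro x _
    rw [eventually_all_finite hP]
    intro y _
    by_cases hxy : x = y
    · simp [hxy]
    · filter_upwards [hsmall _ (dist_pos.2 hxy)] with s hs _ using hs
  have h2 : ∀ᶠ s : ℝ in 𝓝[>] 0, ∀ Q ∈ hP.toFinset.powerset, Q.Nonempty →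
      (⋂ x ∈ Q, Metric.closedBall x (r + (d * s + d * s))).Nonempty →
      (⋂ x ∈ Q, Metric.closedBall x r).Nonempty := by
    rw [eventually_all_finset]
    intro Q _
    by_cases hQ : Q.Nonempty ∧ ¬ (⋂ x ∈ Q, Metric.closedBall x r).Nonempty
    · obtain ⟨δ, hδ, hne⟩ : ∃ δ > 0, ¬ (⋂ x ∈ Q, Metric.closedBall x (r + δ)).Nonempty := by
        by_contra! h
        exact hQ.2 (nonempty_iInter_closedBall_of_forall_add hQ.1 h)
      filter_upwards [hsmall δ hδ] with s hs _ h
      refine (hne (h.mono ?_)).elim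
      exact Set.iInter₂_mono fun x _ => Metric.closedBall_subset_closedBall (by linarith)
    · refine Eventually.of_forall fun s hne _ => ?_
      by_contra h
      exact hQ ⟨hne, h⟩
  filter_upwards [h1, h2, self_mem_nhdsWithin] with s h1 h2 hs
  rw [Set.mem_Ioi] at hs
  have hφ : ∀ x, dist (cellCorner s (cellIndex s x)) x ≤ d * s := dist_cellCorner_cellIndex_le hs
  obtain ⟨e, he⟩ := exists_perm_eqOn hP (φ := fun x => cellCorner s (cellIndex s x)) (by
    intro x hx y hy hxy
    by_contra hne
    have h3 := h1 x hx y hy hne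
    have h4 := dist_triangle_left x y (cellCorner s (cellIndex s x))
    have h5 := hφ y
    simp only at hxy
    rw [← hxy] at h5
    linarith [hφ x])
  refine (finrank_homology_congr (e := e) ?_ ?_ k).symm
  · rintro Q ⟨hQ, hQP, y, hy⟩
    refine ⟨hQ.map, ?_, y, ?_⟩
    · intro x hx
      obtain ⟨q, hq, rfl⟩ := Finset.mem_map.1 (Finset.mem_coe.1 hx)
      exact ⟨_, ⟨q, hQP hq, rfl⟩, (he (hQP hq)).symm⟩
    · simp only [Set.mem_iInter, Metric.mem_closedBall] at hy ⊢
      intro x hx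
      obtain ⟨q, hq, rfl⟩ := Finset.mem_map.1 hx
      have h3 := hy q hq
      have h4 := hφ q
      have h5 : e q = cellCorner s (cellIndex s q) := he (hQP hq)
      have h6 := dist_triangle_right y (e q) q
      rw [h5] at h6
      simp only [Equiv.coe_toEmbedding]
      rw [h5]
      linarith
  · rintro Q ⟨hQ, hQP, y, hy⟩
    have hmem : ∀ x ∈ Q, e.symm x ∈ P := by
      intro x hx
      obtain ⟨_, ⟨q, hq, rfl⟩, rfl⟩ := hQP hx
      have h5 : e q = cellCorner s (cellIndex s q) := he hq
      rw [← h5, Equiv.symm_apply_apply]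
      exact hq
    have hsub : Q.map e.symm.toEmbedding ⊆ hP.toFinset := by
      intro x hx
      obtain ⟨q, hq, rfl⟩ := Finset.mem_map.1 hx
      exact (Set.Finite.mem_toFinset hP).2 (hmem q hq)
    refine ⟨hQ.map, fun x hx => (Set.Finite.mem_toFinset hP).1 (hsub hx),
      h2 _ (Finset.mem_powerset.2 hsub) hQ.map ⟨y, ?_⟩⟩
    simp only [Set.mem_iInter, Metric.mem_closedBall] at hy ⊢
    intro x hx
    obtain ⟨q, hq, rfl⟩ := Finset.mem_map.1 hx
    have h3 := hy q hq
    have h5 : e (e.symm q) = cellCorner s (cellIndex s (e.symm q)) := he (hmem q hq)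
    have h4 := hφ (e.symm q)
    rw [← h5, Equiv.apply_symm_apply] at h4
    have h6 := dist_triangle y q (e.symm q)
    simp only [Equiv.coe_toEmbedding]
    linarith

end Grid

/-! ### Measurability of Betti numbers -/

section Measurability

variable {d : ℕ} {Ω : Type*} [MeasurableSpace Ω] {μ : Measure Ω}
  {P : Ω → Set (EuclideanSpace ℝ (Fin d))}

theorem measurableSet_finite
    (hP : ∀ A, MeasurableSet A → Measurable fun ω => (P ω ∩ A).encard) :
    MeasurableSet {ω | (P ω).Finite} := by
  have h := hP Set.univ MeasurableSet.univ
  simp only [Set.inter_univ] at h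
  have : {ω | (P ω).Finite} = (fun ω => (P ω).encard) ⁻¹' {⊤}ᶜ := by
    ext ω
    simp [Set.encard_eq_top_iff]
  rw [this]
  exact h (measurableSet_singleton _).compl

/-- A function of the set of cells that contain points of a finite random set is measurable. -/
theorem measurable_cells [DecidablePred fun ω => (P ω).Finite]
    (hP : ∀ A, MeasurableSet A → Measurable fun ω => (P ω ∩ A).encard) (s : ℝ)
    (g : Set (Fin d → ℤ) → ℕ) :
    Measurable fun ω => if (P ω).Finite then g (cellIndex s '' P ω) else 0 := by
  classical
  have hfin := measurableSet_finite hP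
  -- Being exactly the set of occupied cells is a countable conjunction of conditions on counts, and
  -- there are only countably many finite sets `F`.
  have hcell : ∀ F : Finset (Fin d → ℤ), MeasurableSet {ω | cellIndex s '' P ω = F} := by
    intro F
    have : {ω | cellIndex s '' P ω = F} =
        ⋂ z : Fin d → ℤ, {ω | (P ω ∩ cellIndex s ⁻¹' {z}).encard ≠ 0 ↔ z ∈ F} := by
      ext ω
      simp only [Set.mem_ofPred_eq, Set.mem_iInter, Set.ext_iff, Finset.mem_coe]
      refine forall_congr' fun z => ?_
      rw [Set.encard_ne_zero]
      simp [Set.Nonempty]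
    rw [this]
    refine MeasurableSet.iInter fun z => ?_
    have h0 : MeasurableSet {ω | (P ω ∩ cellIndex s ⁻¹' {z}).encard ≠ 0} :=
      hP _ (measurable_cellIndex s (measurableSet_singleton z)) (measurableSet_singleton 0).compl
    by_cases hz : z ∈ F
    · simpa only [hz, iff_true] using h0
    · simp only [hz, iff_false]
      exact h0.compl
  refine measurable_to_countable' fun b => ?_
  have : (fun ω => if (P ω).Finite then g (cellIndex s '' P ω) else 0) ⁻¹' {b} =
      ({ω | (P ω).Finite} ∩ ⋃ F : Finset (Fin d → ℤ), ⋃ _ : g F = b, {ω | cellIndex s '' P ω = F}) ∪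
        ({ω | (P ω).Finite}ᶜ ∩ {_ω | 0 = b}) := by
    ext ω
    by_cases h : (P ω).Finite
    · simp only [Set.mem_preimage, h, if_true, Set.mem_singleton_iff, Set.mem_union, Set.mem_inter_iff,
        Set.mem_ofPred_eq, true_and, Set.mem_iUnion, Set.mem_compl_iff, not_true, false_and, or_false]
      constructor
      · intro hb
        exact ⟨(h.image _).toFinset, by simpa using hb, by simp⟩
      · rintro ⟨F, hF, hF'⟩
        rw [hF', hF]
    · simp [h]
  rw [this]
  refine (hfin.inter (MeasurableSet.iUnion fun F => MeasurableSet.iUnion fun _ => hcell F)).union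
    (hfin.compl.inter (MeasurableSet.const _))

/-- The Betti numbers of an almost surely finite random set are measurable. -/
theorem aemeasurable_betti (𝕂 : Type*) [Field 𝕂] (k : ℕ)
    (hP : ∀ A, MeasurableSet A → Measurable fun ω => (P ω ∩ A).encard)
    (hfin : ∀ᵐ ω ∂μ, (P ω).Finite) (r : ℝ) : AEMeasurable (fun ω => betti 𝕂 k (P ω) r) μ := by
  classical
  refine ⟨fun ω => if (P ω).Finite then betti 𝕂 k (P ω) r else 0, ?_, by
    filter_upwards [hfin] with ω h using (if_pos h).symm⟩
  have hlim : Tendsto (fun n : ℕ => 1 / ((n : ℝ) + 1)) atTop (𝓝[>] 0) :=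
    tendsto_nhdsWithin_iff.2 ⟨tendsto_one_div_add_atTop_nhds_zero_nat,
      Eventually.of_forall fun n => Set.mem_Ioi.2 Nat.one_div_pos_of_nat⟩
  refine measurable_of_tendsto_metrizable (fun n : ℕ => measurable_cells hP (1 / ((n : ℝ) + 1))
    fun F => betti 𝕂 k (cellCorner (1 / ((n : ℝ) + 1)) '' F) (r + d * (1 / ((n : ℝ) + 1)))) ?_
  rw [tendsto_pi_nhds]
  intro ω
  by_cases h : (P ω).Finite
  · simp only [h, if_true]
    exact tendsto_nhds_of_eventually_eq (hlim.eventually (eventually_betti_grid_eq 𝕂 k h r))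
  · simp [h]

end Measurability

/-! ### Counts and factorial moments of Poisson processes -/

section Poisson

variable {d : ℕ} {Ω : Type*} [MeasurableSpace Ω] {μ : Measure Ω}
  {P : Ω → Set (EuclideanSpace ℝ (Fin d))} {lam : EuclideanSpace ℝ (Fin d) → ℝ}

theorem IsPoissonProcess.ae_finite (hP : IsPoissonProcess μ P lam)
    (hlam : ∫⁻ x, ENNReal.ofReal (lam x) ≠ ⊤) : ∀ᵐ ω ∂μ, (P ω).Finite := by
  have h := hP.map_count Set.univ MeasurableSet.univ (by rwa [setLIntegral_univ])
  have hm := hP.measurable_count Set.univ MeasurableSet.univ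
  simp only [Set.inter_univ] at h hm
  have h1 := congrArg (fun ν => ν {⊤}) h
  rw [Measure.map_apply hm (measurableSet_singleton _),
    Measure.map_apply .of_discrete (measurableSet_singleton _)] at h1
  have h2 : (Nat.cast : ℕ → ℕ∞) ⁻¹' {⊤} = ∅ := by ext n; simp
  rw [h2, measure_empty] at h1
  rw [ae_iff]
  convert h1 using 2
  ext ω
  simp [Set.encard_eq_top_iff]

theorem IsPoissonProcess.measure_count_eq (hP : IsPoissonProcess μ P lam)
    {A : Set (EuclideanSpace ℝ (Fin d))} (hA : MeasurableSet A)
    (hlam : ∫⁻ x in A, ENNReal.ofReal (lam x) ≠ ⊤) (n : ℕ) :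
    μ {ω | (P ω ∩ A).encard = n} =
      poissonMeasure (∫⁻ x in A, ENNReal.ofReal (lam x)).toNNReal {n} := by
  have h1 := congrArg (fun ν => ν {(n : ℕ∞)}) (hP.map_count A hA hlam)
  rw [Measure.map_apply (hP.measurable_count A hA) (measurableSet_singleton _),
    Measure.map_apply .of_discrete (measurableSet_singleton _)] at h1
  have h2 : (Nat.cast : ℕ → ℕ∞) ⁻¹' {(n : ℕ∞)} = {n} := by ext n; simp
  rw [h2] at h1
  exact h1

/-- The factorial moments of the Poisson distribution. -/
theorem lintegral_descFactorial_poissonMeasure (t : NNReal) (m : ℕ) :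
    ∫⁻ n, (n.descFactorial m : ENNReal) ∂(poissonMeasure t) = (t : ENNReal) ^ m := by
  have hs : HasSum (fun n : ℕ => Real.exp (-t) * t ^ n / n.factorial * n.descFactorial m)
      ((t : ℝ) ^ m) := by
    -- The terms below `m` vanish; the term at `n + m` is `t ^ m` times the Poisson weight of `n`.
    rw [← hasSum_nat_add_iff' m, Finset.sum_eq_zero, sub_zero]
    · have h := (hasSum_one_poissonMeasure t).mul_left ((t : ℝ) ^ m)
      rw [mul_one] at h
      refine h.congr_fun fun n => ?_
      have h1 := Nat.factorial_mul_descFactorial (Nat.le_add_left m n)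
      rw [Nat.add_sub_cancel] at h1
      rw [← h1]
      have h2 : ((n + m).descFactorial m : ℝ) ≠ 0 := by
        rw [Nat.cast_ne_zero, Ne, Nat.descFactorial_eq_zero_iff_lt]
        omega
      have h3 : (n.factorial : ℝ) ≠ 0 := by exact_mod_cast n.factorial_ne_zero
      push_cast
      field_simp
      ring
    · intro i hi
      rw [Nat.descFactorial_eq_zero_iff_lt.2 (Finset.mem_range.1 hi)]
      simp
  rw [poissonMeasure, lintegral_sum_measure]
  simp only [lintegral_smul_measure, lintegral_dirac, smul_eq_mul]
  calc ∑' n : ℕ, ENNReal.ofReal (Real.exp (-t) * t ^ n / n.factorial) * (n.descFactorial m : ENNReal)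
      = ∑' n : ℕ, ENNReal.ofReal (Real.exp (-t) * t ^ n / n.factorial * n.descFactorial m) := by
        refine tsum_congr fun n => ?_
        rw [ENNReal.ofReal_mul (by positivity), ENNReal.ofReal_natCast]
    _ = ENNReal.ofReal ((t : ℝ) ^ m) := by
        rw [← ENNReal.ofReal_tsum_of_nonneg (fun n => by positivity) hs.summable, hs.tsum_eq]
    _ = (t : ENNReal) ^ m := by
        rw [ENNReal.ofReal_pow (NNReal.coe_nonneg t), ENNReal.ofReal_coe_nnreal]

theorem IsPoissonProcess.lintegral_descFactorial (hP : IsPoissonProcess μ P lam)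
    {A : Set (EuclideanSpace ℝ (Fin d))} (hA : MeasurableSet A)
    (hlam : ∫⁻ x in A, ENNReal.ofReal (lam x) ≠ ⊤) (m : ℕ) :
    ∫⁻ ω, ((P ω ∩ A).ncard.descFactorial m : ENNReal) ∂μ =
      (∫⁻ x in A, ENNReal.ofReal (lam x)) ^ m := by
  have h1 : Measurable fun n : ℕ∞ => (n.toNat.descFactorial m : ENNReal) := measurable_of_countable _
  calc ∫⁻ ω, ((P ω ∩ A).ncard.descFactorial m : ENNReal) ∂μ
      = ∫⁻ n, (n.toNat.descFactorial m : ENNReal) ∂(μ.map fun ω => (P ω ∩ A).encard) := by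
        rw [lintegral_map h1 (hP.measurable_count A hA)]
        rfl
    _ = _ := by
        rw [hP.map_count A hA hlam, lintegral_map h1 .of_discrete]
        simp only [ENat.toNat_natCast]
        rw [lintegral_descFactorial_poissonMeasure, ENNReal.coe_toNNReal hlam]

end Poisson

/-! ### The upper bound by counting tuples in grid neighbourhoods -/

section UpperBound

variable {d : ℕ}

/-- The union of the grid cubes at index distance at most `3` from the cube with index `z`. -/
def cellNeighbourhood (r : ℝ) (z : Fin d → ℤ) : Set (EuclideanSpace ℝ (Fin d)) :=
  cellIndex r ⁻¹' {w | ∀ i, |w i - z i| ≤ 3}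

theorem measurableSet_cellNeighbourhood (r : ℝ) (z : Fin d → ℤ) :
    MeasurableSet (cellNeighbourhood r z) :=
  measurable_cellIndex r (Set.to_countable _).measurableSet

theorem abs_apply_sub_le_dist (x y : EuclideanSpace ℝ (Fin d)) (i : Fin d) :
    |x i - y i| ≤ dist x y := by
  rw [dist_eq_norm]
  exact PiLp.norm_apply_le (x - y) i

theorem mem_cellNeighbourhood_of_dist_le {r : ℝ} (hr : 0 < r) {x y : EuclideanSpace ℝ (Fin d)}
    (h : dist x y ≤ 2 * r) : y ∈ cellNeighbourhood r (cellIndex r x) := by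
  intro i
  have h1 := (abs_le.1 ((abs_apply_sub_le_dist x y i).trans h))
  have h2 := Int.floor_le (x i / r)
  have h3 := Int.lt_floor_add_one (x i / r)
  have h4 := Int.floor_le (y i / r)
  have h5 := Int.lt_floor_add_one (y i / r)
  have h6 : x i / r - y i / r ≤ 2 := by rw [← sub_div, div_le_iff₀ hr]; exact h1.2
  have h7 : -2 ≤ x i / r - y i / r := by rw [← sub_div, le_div_iff₀ hr]; linarith [h1.1]
  simp only [cellIndex]
  rw [abs_le]
  constructor
  · have : (-3 : ℝ) ≤ ⌊y i / r⌋ - ⌊x i / r⌋ := by linarith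
    exact_mod_cast this
  · have : (⌊y i / r⌋ - ⌊x i / r⌋ : ℝ) ≤ 3 := by linarith
    exact_mod_cast this

theorem cellNeighbourhood_subset_closedBall {r : ℝ} (hr : 0 < r) (z : Fin d → ℤ) :
    cellNeighbourhood r z ⊆ Metric.closedBall (cellCorner r z) (d * (4 * r)) := by
  intro x hx
  refine dist_le_of_forall_abs_sub_le (by positivity) fun i => ?_
  have h1 := abs_le.1 (hx i)
  simp only [cellIndex] at h1
  have h2 := Int.floor_le (x i / r)
  have h3 := Int.lt_floor_add_one (x i / r)
  rw [le_div_iff₀ hr] at h2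
  rw [div_lt_iff₀ hr] at h3
  have h4 : (-3 : ℝ) ≤ ⌊x i / r⌋ - z i := by exact_mod_cast h1.1
  have h5 : (⌊x i / r⌋ - z i : ℝ) ≤ 3 := by exact_mod_cast h1.2
  simp only [cellCorner]
  rw [abs_le]
  constructor <;> nlinarith

/-- A point lies in at most `7 ^ d` of the sets `cellNeighbourhood r z`. -/
theorem tsum_indicator_cellNeighbourhood_le (r : ℝ) (x : EuclideanSpace ℝ (Fin d)) :
    ∑' z, (cellNeighbourhood r z).indicator (fun _ => (1 : ENNReal)) x ≤ 7 ^ d := by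
  classical
  let c := cellIndex r x
  let S : Finset (Fin d → ℤ) := Fintype.piFinset fun i => Finset.Icc (c i - 3) (c i + 3)
  rw [tsum_eq_sum (s := S)]
  · calc ∑ z ∈ S, (cellNeighbourhood r z).indicator (fun _ => (1 : ENNReal)) x ≤ ∑ _z ∈ S, 1 :=
          Finset.sum_le_sum fun z _ => Set.indicator_le_self' (fun _ _ => zero_le) x
      _ = 7 ^ d := by
          have h7 : ∀ i, (c i + 3 + 1 - (c i - 3)).toNat = 7 := fun i => by omega
          simp [S, h7]
  · intro z hz
    refine Set.indicator_of_notMem (fun hx => hz ?_) _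
    refine Fintype.mem_piFinset.2 fun i => Finset.mem_Icc.2 ?_
    have h1 := abs_le.1 (hx i)
    constructor <;> simp only [c] <;> omega

/-- Bounded overlap, integrated: the total mass over all cells is finite and independent of `r` up
to a constant. -/
theorem tsum_lintegral_cellNeighbourhood_le (r : ℝ)
    {g : EuclideanSpace ℝ (Fin d) → ENNReal} (hg : Measurable g) :
    ∑' z, ∫⁻ x in cellNeighbourhood r z, g x ≤ 7 ^ d * ∫⁻ x, g x := by
  calc ∑' z, ∫⁻ x in cellNeighbourhood r z, g x
      = ∑' z, ∫⁻ x, (cellNeighbourhood r z).indicator (fun _ => (1 : ENNReal)) x * g x := by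
        refine tsum_congr fun z => ?_
        rw [← lintegral_indicator (measurableSet_cellNeighbourhood r z)]
        refine lintegral_congr fun x => ?_
        by_cases hx : x ∈ cellNeighbourhood r z <;> simp [hx]
    _ = ∫⁻ x, ∑' z, (cellNeighbourhood r z).indicator (fun _ => (1 : ENNReal)) x * g x := by
        rw [lintegral_tsum]
        exact fun z => ((measurable_const.indicator
          (measurableSet_cellNeighbourhood r z)).mul hg).aemeasurable
    _ ≤ ∫⁻ x, 7 ^ d * g x := by
        refine lintegral_mono fun x => ?_
        rw [ENNReal.tsum_mul_right]
        gcongr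
        exact tsum_indicator_cellNeighbourhood_le r x
    _ = 7 ^ d * ∫⁻ x, g x := lintegral_const_mul _ hg

/-- The falling factorial is kept because its Poisson expectation is exactly a power of the mass. -/
theorem ncard_injective_le {V : Type*} {A : Set V} (hA : A.Finite) (m : ℕ) :
    {ρ : Fin m → V | Function.Injective ρ ∧ ∀ i, ρ i ∈ A}.ncard ≤ A.ncard.descFactorial m := by
  have := hA.fintype
  have h : {ρ : Fin m → V | Function.Injective ρ ∧ ∀ i, ρ i ∈ A} ⊆
      (fun (f : Fin m ↪ A) i => (f i : V)) '' Set.univ := by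
    rintro ρ ⟨hρ, hρA⟩
    exact ⟨⟨fun i => ⟨ρ i, hρA i⟩, fun i j h => hρ (congrArg Subtype.val h)⟩, trivial, rfl⟩
  refine (Set.ncard_le_ncard h (Set.toFinite _)).trans
    ((Set.ncard_image_le (Set.toFinite _)).trans ?_)
  rw [Set.ncard_univ, Nat.card_eq_fintype_card, Fintype.card_embedding_eq, Fintype.card_fin,
    Set.ncard_eq_toFinset_card', Set.toFinset_card]

theorem dist_le_of_cycle_apply_ne_zero {𝕂 : Type*} [Field 𝕂] {k : ℕ} {r : ℝ}
    {P : Set (EuclideanSpace ℝ (Fin d))} {c : (Fin (k + 1) → EuclideanSpace ℝ (Fin d)) →₀ 𝕂}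
    (hc : c ∈ cycles 𝕂 (cech r P) k) {σ : Fin (k + 1) → EuclideanSpace ℝ (Fin d)} (hσ : c σ ≠ 0)
    (i j : Fin (k + 1)) : dist (σ i) (σ j) ≤ 2 * r := by
  obtain ⟨-, s, ⟨-, -, y, hy⟩, hs⟩ := (cycles_le_chains _ k hc).1 σ hσ
  simp only [Set.mem_iInter, Metric.mem_closedBall] at hy
  have hi := hy (σ i) (Finset.mem_coe.1 (hs.symm ▸ ⟨i, rfl⟩))
  have hj := hy (σ j) (Finset.mem_coe.1 (hs.symm ▸ ⟨j, rfl⟩))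
  linarith [dist_triangle_left (σ i) (σ j) y]

theorem betti_le_tsum (𝕂 : Type*) [Field 𝕂] (k : ℕ) {r : ℝ} (hr : 0 < r)
    {P : Set (EuclideanSpace ℝ (Fin d))} (hP : P.Finite) :
    (betti 𝕂 (k + 1) P r : ENNReal) ≤
      ∑' z, ((P ∩ cellNeighbourhood r z).ncard.descFactorial (k + 3) : ENNReal) := by
  classical
  let R : (Fin d → ℤ) → Set (Fin (k + 3) → EuclideanSpace ℝ (Fin d)) := fun z =>
    {ρ | Function.Injective ρ ∧ ∀ i, ρ i ∈ P ∩ cellNeighbourhood r z}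
  let Z : Finset (Fin d → ℤ) := (hP.image (cellIndex r)).toFinset
  have hR : ∀ z, (R z).Finite := fun z =>
    (Set.Finite.pi' fun _ : Fin (k + 3) => hP).subset fun ρ hρ i => (hρ.2 i).1
  have hU : (⋃ z ∈ Z, R z).Finite := Set.Finite.biUnion Z.finite_toSet fun z _ => hR z
  have h1 : betti 𝕂 (k + 1) P r ≤ (Fin.tail '' (⋃ z ∈ Z, R z)).ncard := by
    refine finrank_homology_le (hU.image _) fun c hc σ hσ => ?_
    obtain ⟨v, hv, hv'⟩ := exists_extra_vertex hc hσ
    refine ⟨Fin.cons v σ, ?_, Fin.tail_cons _ _⟩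
    simp only [Set.mem_iUnion]
    have hσP := mem_of_cycle_apply_ne_zero hc hσ
    -- The cell is that of `σ 1`, not `σ 0`: `σ 1` belongs both to `σ` and to the neighbouring
    -- simplex in which `v` replaces `σ 0`, so all points are within `2 * r` of it.
    refine ⟨cellIndex r (σ 1), by simpa [Z] using ⟨_, hσP 1, rfl⟩,
      Fin.cons_injective_iff.2 ⟨hv, ((cycles_le_chains _ _ hc).1 σ hσ).1⟩, fun i => ?_⟩
    cases i using Fin.cases with
    | zero =>
      refine ⟨mem_of_cycle_apply_ne_zero hc hv' 0, mem_cellNeighbourhood_of_dist_le hr ?_⟩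
      exact dist_le_of_cycle_apply_ne_zero hc hv' 1 0
    | succ i =>
      exact ⟨hσP i, mem_cellNeighbourhood_of_dist_le hr (dist_le_of_cycle_apply_ne_zero hc hσ 1 i)⟩
  have h2 : betti 𝕂 (k + 1) P r ≤
      ∑ z ∈ Z, (P ∩ cellNeighbourhood r z).ncard.descFactorial (k + 3) :=
    calc betti 𝕂 (k + 1) P r ≤ (⋃ z ∈ Z, R z).ncard := h1.trans (Set.ncard_image_le hU)
      _ ≤ ∑ z ∈ Z, (R z).ncard := Finset.set_ncard_biUnion_le Z R
      _ ≤ _ := Finset.sum_le_sum fun z _ => ncard_injective_le (hP.inter_of_left _) _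
  calc (betti 𝕂 (k + 1) P r : ENNReal)
      ≤ ∑ z ∈ Z, ((P ∩ cellNeighbourhood r z).ncard.descFactorial (k + 3) : ENNReal) := by
        exact_mod_cast h2
    _ ≤ _ := ENNReal.sum_le_tsum Z

/-- If the expected numbers of points in the sets `cellNeighbourhood r z` are at most `M`, then the
expected Betti number is at most `7 ^ d * M ^ (k + 2)` times the expected number of points. -/
theorem IsPoissonProcess.lintegral_betti_le {Ω : Type*} [MeasurableSpace Ω] {μ : Measure Ω}
    {P : Ω → Set (EuclideanSpace ℝ (Fin d))} {lam : EuclideanSpace ℝ (Fin d) → ℝ}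
    (hP : IsPoissonProcess μ P lam) (hmeas : Measurable lam)
    (hlam : ∫⁻ x, ENNReal.ofReal (lam x) ≠ ⊤) (𝕂 : Type*) [Field 𝕂] (k : ℕ) {r : ℝ} (hr : 0 < r)
    {M : ENNReal} (hM : ∀ z, ∫⁻ x in cellNeighbourhood r z, ENNReal.ofReal (lam x) ≤ M) :
    ∫⁻ ω, (betti 𝕂 (k + 1) (P ω) r : ENNReal) ∂μ ≤
      M ^ (k + 2) * (7 ^ d * ∫⁻ x, ENNReal.ofReal (lam x)) := by
  have hfin : ∀ z : Fin d → ℤ, ∫⁻ x in cellNeighbourhood r z, ENNReal.ofReal (lam x) ≠ ⊤ := fun z =>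
    ne_top_of_le_ne_top hlam (setLIntegral_le_lintegral _ _)
  have hdesc : Measurable fun n : ℕ∞ => (n.toNat.descFactorial (k + 3) : ENNReal) :=
    measurable_of_countable _
  calc ∫⁻ ω, (betti 𝕂 (k + 1) (P ω) r : ENNReal) ∂μ
      ≤ ∫⁻ ω, ∑' z, ((P ω ∩ cellNeighbourhood r z).ncard.descFactorial (k + 3) : ENNReal) ∂μ := by
        refine lintegral_mono_ae ?_
        filter_upwards [hP.ae_finite hlam] with ω hω using betti_le_tsum 𝕂 k hr hω
    _ = ∑' z, (∫⁻ x in cellNeighbourhood r z, ENNReal.ofReal (lam x)) ^ (k + 3) := by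
        rw [lintegral_tsum]
        · exact tsum_congr fun z =>
            hP.lintegral_descFactorial (measurableSet_cellNeighbourhood r z) (hfin z) _
        · exact fun z => (hdesc.comp
            (hP.measurable_count _ (measurableSet_cellNeighbourhood r z))).aemeasurable
    _ ≤ ∑' z, M ^ (k + 2) * ∫⁻ x in cellNeighbourhood r z, ENNReal.ofReal (lam x) := by
        refine ENNReal.tsum_le_tsum fun z => ?_
        -- All factors but one are bounded by `M`; the remaining one is summed over the cells and
        -- gives the total mass.
        rw [pow_succ]
        gcongr
        exact hM z
    _ ≤ _ := by
        rw [ENNReal.tsum_mul_left]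
        gcongr
        exact tsum_lintegral_cellNeighbourhood_le r hmeas.ennreal_ofReal

end UpperBound

/-! ### Isolated empty simplices and their probability -/

section IsolatedSimplices

variable {d : ℕ}

/-- Each ball of radius `ε r` about a point `x + r v i` contains exactly one point of `P`, and the
ball of radius `L r` about `x` contains no other points of `P`. -/
def HasIsolatedSimplex {m : ℕ} (v : Fin m → EuclideanSpace ℝ (Fin d)) (ε L r : ℝ)
    (P : Set (EuclideanSpace ℝ (Fin d))) (x : EuclideanSpace ℝ (Fin d)) : Prop :=
  (∀ i, (P ∩ Metric.closedBall (x + r • v i) (ε * r)).encard = 1) ∧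
    (P ∩ (Metric.closedBall x (L * r) \
      ⋃ i, Metric.closedBall (x + r • v i) (ε * r))).encard = 0

theorem closedBall_subset_of_le {m : ℕ} {v : Fin m → EuclideanSpace ℝ (Fin d)} {ε L r : ℝ}
    (hr : 0 < r) (hL : ∀ i, ‖v i‖ + ε ≤ L) (x : EuclideanSpace ℝ (Fin d)) (i : Fin m) :
    Metric.closedBall (x + r • v i) (ε * r) ⊆ Metric.closedBall x (L * r) := by
  refine Metric.closedBall_subset_closedBall' ?_
  rw [dist_self_add_left, norm_smul, Real.norm_of_nonneg hr.le]
  nlinarith [hL i]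

/-- The unique points in the small balls form an empty simplex about each centre. The summand `2` in
`hL` isolates it: a point sharing a face with one of its vertices is within `2 * r` of that vertex,
hence in the ball of radius `L * r`, which contains no other points. -/
theorem card_le_betti (𝕂 : Type*) [Field 𝕂] {k : ℕ} {v : Fin (k + 2) → EuclideanSpace ℝ (Fin d)}
    {ε L r : ℝ} (h1 : ∀ j, ∃ y, ∀ i, i ≠ j → dist (v i) y ≤ 1 - ε)
    (h2 : ∀ y, ∃ i, 1 + ε < dist (v i) y) (hr : 0 < r) (hL : ∀ i, ‖v i‖ + ε + 2 ≤ L)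
    {P : Set (EuclideanSpace ℝ (Fin d))} (hP : P.Finite) {F : Finset (EuclideanSpace ℝ (Fin d))}
    (hF : ∀ x ∈ F, ∀ y ∈ F, x ≠ y → 2 * (L * r) < dist x y)
    (hiso : ∀ x ∈ F, HasIsolatedSimplex v ε L r P x) : F.card ≤ betti 𝕂 k P r := by
  classical
  have hex : ∀ x : F, ∀ i, ∃ w, P ∩ Metric.closedBall ((x : EuclideanSpace ℝ (Fin d)) + r • v i)
      (ε * r) = {w} := fun x i => Set.encard_eq_one.1 ((hiso x x.2).1 i)
  choose w hw using hex
  have hwP : ∀ (x : F) i, w x i ∈ P := fun x i => ((hw x i).symm ▸ Set.mem_singleton (w x i) :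
    w x i ∈ P ∩ _).1
  have hwB : ∀ (x : F) i, w x i ∈ Metric.closedBall ((x : EuclideanSpace ℝ (Fin d)) + r • v i)
      (ε * r) := fun x i => ((hw x i).symm ▸ Set.mem_singleton (w x i) : w x i ∈ P ∩ _).2
  have hempty : ∀ x : F, IsEmptySimplex r (w x) := fun x =>
    isEmptySimplex_of_dist_le h1 h2 hr x (hwB x)
  have hdist : ∀ (x : F) i, dist (w x i) (x : EuclideanSpace ℝ (Fin d)) ≤ (L - 2) * r := fun x i => by
    have hsub : Metric.closedBall ((x : EuclideanSpace ℝ (Fin d)) + r • v i) (ε * r) ⊆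
        Metric.closedBall (x : EuclideanSpace ℝ (Fin d)) ((L - 2) * r) :=
      closedBall_subset_of_le hr (fun i => by linarith [hL i]) _ i
    exact Metric.mem_closedBall.1 (hsub (hwB x i))
  rw [← Fintype.card_coe]
  refine card_le_finrank_homology hP cech_faces_subset w (fun x => (hempty x).injective) ?_
    (fun x => (hempty x).facet_mem_cech (hwP x)) ?_
  · intro x y hxy
    rw [Set.disjoint_left]
    rintro _ ⟨i, rfl⟩ ⟨j, hj⟩
    have h3 := hF x x.2 y y.2 fun h => hxy (Subtype.ext h)
    have h4 := hdist x i
    have h5 := hdist y j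
    rw [hj] at h5
    have h6 := dist_triangle_left (x : EuclideanSpace ℝ (Fin d)) y (w x i)
    nlinarith
  · rintro x s hs ⟨_, hps, i, rfl⟩
    refine (hempty x).ssubset hs fun q hq => ?_
    have hqP : q ∈ P := hs.2.1 hq
    obtain ⟨-, -, y, hy⟩ := hs
    simp only [Set.mem_iInter, Metric.mem_closedBall] at hy
    have hqD : q ∈ Metric.closedBall (x : EuclideanSpace ℝ (Fin d)) (L * r) := by
      rw [Metric.mem_closedBall]
      have h3 := hy q hq
      have h4 := hy _ hps
      have h5 := dist_triangle_left q (w x i) y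
      have h6 := dist_triangle q (w x i) x
      nlinarith [hdist x i]
    have h0 := Set.encard_eq_zero.1 (hiso x x.2).2
    have hqB : q ∈ ⋃ i, Metric.closedBall ((x : EuclideanSpace ℝ (Fin d)) + r • v i) (ε * r) := by
      by_contra h
      have : q ∈ (∅ : Set (EuclideanSpace ℝ (Fin d))) := h0 ▸ ⟨hqP, hqD, h⟩
      exact this
    obtain ⟨j, hj⟩ := Set.mem_iUnion.1 hqB
    have : q ∈ ({w x j} : Set (EuclideanSpace ℝ (Fin d))) := hw x j ▸ ⟨hqP, hj⟩
    exact ⟨j, this.symm⟩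

/-- A common point could serve as two vertices of a perturbed empty simplex, whose vertices are
distinct. -/
theorem disjoint_closedBall_of_robust {m : ℕ} {v : Fin (m + 1) → EuclideanSpace ℝ (Fin d)}
    {ε r : ℝ} (h1 : ∀ j, ∃ y, ∀ i, i ≠ j → dist (v i) y ≤ 1 - ε)
    (h2 : ∀ y, ∃ i, 1 + ε < dist (v i) y) (hε : 0 ≤ ε) (hr : 0 < r)
    (x : EuclideanSpace ℝ (Fin d)) {i j : Fin (m + 1)} (hij : i ≠ j) :
    Disjoint (Metric.closedBall (x + r • v i) (ε * r))
      (Metric.closedBall (x + r • v j) (ε * r)) := by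
  classical
  rw [Set.disjoint_left]
  intro p hpi hpj
  let w : Fin (m + 1) → EuclideanSpace ℝ (Fin d) := fun l =>
    if l = i ∨ l = j then p else x + r • v l
  have hw : IsEmptySimplex r w := by
    refine isEmptySimplex_of_dist_le h1 h2 hr x fun l => ?_
    by_cases hl : l = i ∨ l = j
    · simp only [w, hl, if_true]
      rcases hl with rfl | rfl
      · exact hpi
      · exact hpj
    · simp only [w, hl, if_false, dist_self]
      positivity
  exact hij (hw.injective (by simp [w]))

variable {Ω : Type*} [MeasurableSpace Ω] {μ : Measure Ω}
  {P : Ω → Set (EuclideanSpace ℝ (Fin d))} {lam : EuclideanSpace ℝ (Fin d) → ℝ}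

theorem measurableSet_hasIsolatedSimplex
    (hP : ∀ A, MeasurableSet A → Measurable fun ω => (P ω ∩ A).encard) {m : ℕ}
    (v : Fin m → EuclideanSpace ℝ (Fin d)) (ε L r : ℝ) (x : EuclideanSpace ℝ (Fin d)) :
    MeasurableSet {ω | HasIsolatedSimplex v ε L r (P ω) x} := by
  have h : {ω | HasIsolatedSimplex v ε L r (P ω) x} =
      (⋂ i, (fun ω => (P ω ∩ Metric.closedBall (x + r • v i) (ε * r)).encard) ⁻¹' {1}) ∩
      (fun ω => (P ω ∩ (Metric.closedBall x (L * r) \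
        ⋃ i, Metric.closedBall (x + r • v i) (ε * r))).encard) ⁻¹' {0} := by
    ext ω
    simp [HasIsolatedSimplex]
  rw [h]
  refine (MeasurableSet.iInter fun i => hP _ Metric.isClosed_closedBall.measurableSet
    (measurableSet_singleton _)).inter (hP _ ?_ (measurableSet_singleton _))
  exact Metric.isClosed_closedBall.measurableSet.diff
    (MeasurableSet.iUnion fun i => Metric.isClosed_closedBall.measurableSet)

theorem le_poissonMeasure_one {t : NNReal} (ht : t ≤ 1) {a : ℝ} (ha : 0 ≤ a) (hat : a ≤ t) :
    ENNReal.ofReal (Real.exp (-1) * a) ≤ poissonMeasure t {1} := by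
  rw [poissonMeasure_singleton]
  refine ENNReal.ofReal_le_ofReal ?_
  have ht' : (t : ℝ) ≤ 1 := ht
  simp only [pow_one, Nat.factorial_one, Nat.cast_one, div_one]
  gcongr

theorem le_poissonMeasure_zero {t : NNReal} (ht : t ≤ 1) :
    ENNReal.ofReal (Real.exp (-1)) ≤ poissonMeasure t {0} := by
  rw [poissonMeasure_singleton]
  refine ENNReal.ofReal_le_ofReal ?_
  have ht' : (t : ℝ) ≤ 1 := ht
  simpa using ht'

/-- The event prescribes counts on `m + 2` disjoint sets, so its probability is a product. Total
mass at most `1` keeps every exponential factor above `exp (-1)`. -/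
theorem IsPoissonProcess.le_measure_hasIsolatedSimplex [IsProbabilityMeasure μ]
    (hP : IsPoissonProcess μ P lam) {m : ℕ} {v : Fin (m + 1) → EuclideanSpace ℝ (Fin d)}
    {ε L r : ℝ} (h1 : ∀ j, ∃ y, ∀ i, i ≠ j → dist (v i) y ≤ 1 - ε)
    (h2 : ∀ y, ∃ i, 1 + ε < dist (v i) y) (hε : 0 ≤ ε) (hr : 0 < r) (hL : ∀ i, ‖v i‖ + ε ≤ L)
    {x : EuclideanSpace ℝ (Fin d)}
    (hD : ∫⁻ y in Metric.closedBall x (L * r), ENNReal.ofReal (lam y) ≤ 1) {a : ℝ} (ha : 0 ≤ a)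
    (hB : ∀ i, ENNReal.ofReal a ≤
      ∫⁻ y in Metric.closedBall (x + r • v i) (ε * r), ENNReal.ofReal (lam y)) :
    ENNReal.ofReal (Real.exp (-1) * (Real.exp (-1) * a) ^ (m + 1)) ≤
      μ {ω | HasIsolatedSimplex v ε L r (P ω) x} := by
  classical
  let B : Fin (m + 1) → Set (EuclideanSpace ℝ (Fin d)) := fun i =>
    Metric.closedBall (x + r • v i) (ε * r)
  let D := Metric.closedBall x (L * r)
  have hBm : ∀ i, MeasurableSet (B i) := fun i => Metric.isClosed_closedBall.measurableSet
  let A : Fin (m + 2) → Set (EuclideanSpace ℝ (Fin d)) := Fin.cons (D \ ⋃ i, B i) B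
  have hAm : ∀ i, MeasurableSet (A i) := by
    intro i
    cases i using Fin.cases with
    | zero => exact Metric.isClosed_closedBall.measurableSet.diff (MeasurableSet.iUnion hBm)
    | succ i => exact hBm i
  have hAD : ∀ i, A i ⊆ D := by
    intro i
    cases i using Fin.cases with
    | zero => exact Set.sdiff_subset
    | succ i => exact closedBall_subset_of_le hr hL x i
  have hA1 : ∀ i, ∫⁻ y in A i, ENNReal.ofReal (lam y) ≤ 1 := fun i =>
    (lintegral_mono_set (hAD i)).trans hD
  have hAtop : ∀ i, ∫⁻ y in A i, ENNReal.ofReal (lam y) ≠ ⊤ := fun i =>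
    ne_top_of_le_ne_top ENNReal.one_ne_top (hA1 i)
  have hA1' : ∀ i, (∫⁻ y in A i, ENNReal.ofReal (lam y)).toNNReal ≤ 1 := fun i =>
    ENNReal.toNNReal_mono ENNReal.one_ne_top (hA1 i)
  have hdisj : Pairwise fun i j => Disjoint (A i) (A j) := by
    intro i j hij
    cases i using Fin.cases with
    | zero =>
      obtain ⟨j, rfl⟩ := Fin.exists_succ_eq.2 hij.symm
      exact Set.disjoint_sdiff_left.mono_right (Set.subset_iUnion B j)
    | succ i =>
      cases j using Fin.cases with
      | zero => exact (Set.disjoint_sdiff_left.mono_right (Set.subset_iUnion B i)).symm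
      | succ j => exact disjoint_closedBall_of_robust h1 h2 hε hr x fun h => hij (congrArg Fin.succ h)
  let N : Fin (m + 2) → ℕ := Fin.cons 0 fun _ => 1
  have hG : {ω | HasIsolatedSimplex v ε L r (P ω) x} =
      ⋂ i ∈ (Finset.univ : Finset (Fin (m + 2))),
        (fun ω => (P ω ∩ A i).encard) ⁻¹' {(N i : ℕ∞)} := by
    ext ω
    simp only [Set.mem_ofPred_eq, Finset.mem_univ, Set.iInter_true, Set.mem_iInter,
      Fin.forall_fin_succ (n := m + 1)]
    simp [HasIsolatedSimplex, A, B, D, N, and_comm]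
  rw [hG, (hP.indep_count _ A hAm hdisj).measure_inter_preimage_eq_mul Finset.univ
    (fun i _ => measurableSet_singleton _), Fin.prod_univ_succ]
  have hcount : ∀ i, μ ((fun ω => (P ω ∩ A i).encard) ⁻¹' {(N i : ℕ∞)}) =
      poissonMeasure (∫⁻ y in A i, ENNReal.ofReal (lam y)).toNNReal {N i} := fun i =>
    hP.measure_count_eq (hAm i) (hAtop i) (N i)
  rw [ENNReal.ofReal_mul (by positivity), ENNReal.ofReal_pow (by positivity)]
  refine mul_le_mul' ?_ ?_
  · rw [hcount]
    exact le_poissonMeasure_zero (hA1' 0)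
  · calc ENNReal.ofReal (Real.exp (-1) * a) ^ (m + 1)
        = ∏ _i : Fin (m + 1), ENNReal.ofReal (Real.exp (-1) * a) := by simp
      _ ≤ _ := by
        refine Finset.prod_le_prod' fun i _ => ?_
        rw [hcount]
        refine le_poissonMeasure_one (hA1' _) ha ?_
        have h3 := ENNReal.toReal_mono (hAtop i.succ) (hB i)
        rwa [ENNReal.toReal_ofReal ha] at h3

/-- Linearity of expectation over the centres; no independence between different centres is needed.
-/
theorem IsPoissonProcess.le_lintegral_betti [IsProbabilityMeasure μ]
    (hP : IsPoissonProcess μ P lam) (hlam : ∫⁻ x, ENNReal.ofReal (lam x) ≠ ⊤)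
    (𝕂 : Type*) [Field 𝕂] {k : ℕ} {v : Fin (k + 2) → EuclideanSpace ℝ (Fin d)}
    {ε L r : ℝ} (h1 : ∀ j, ∃ y, ∀ i, i ≠ j → dist (v i) y ≤ 1 - ε)
    (h2 : ∀ y, ∃ i, 1 + ε < dist (v i) y) (hε : 0 ≤ ε) (hr : 0 < r)
    (hL : ∀ i, ‖v i‖ + ε + 2 ≤ L) {F : Finset (EuclideanSpace ℝ (Fin d))}
    (hF : ∀ x ∈ F, ∀ y ∈ F, x ≠ y → 2 * (L * r) < dist x y)
    (hD : ∀ x ∈ F, ∫⁻ y in Metric.closedBall x (L * r), ENNReal.ofReal (lam y) ≤ 1)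
    {a : ℝ} (ha : 0 ≤ a) (hB : ∀ x ∈ F, ∀ i, ENNReal.ofReal a ≤
      ∫⁻ y in Metric.closedBall (x + r • v i) (ε * r), ENNReal.ofReal (lam y)) :
    F.card * ENNReal.ofReal (Real.exp (-1) * (Real.exp (-1) * a) ^ (k + 2)) ≤
      ∫⁻ ω, (betti 𝕂 k (P ω) r : ENNReal) ∂μ := by
  classical
  let G : EuclideanSpace ℝ (Fin d) → Set Ω := fun x => {ω | HasIsolatedSimplex v ε L r (P ω) x}
  have hG : ∀ x, MeasurableSet (G x) := fun x =>
    measurableSet_hasIsolatedSimplex hP.measurable_count v ε L r x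
  calc F.card * ENNReal.ofReal (Real.exp (-1) * (Real.exp (-1) * a) ^ (k + 2))
      = ∑ _x ∈ F, ENNReal.ofReal (Real.exp (-1) * (Real.exp (-1) * a) ^ (k + 2)) := by simp
    _ ≤ ∑ x ∈ F, μ (G x) := Finset.sum_le_sum fun x hx =>
        hP.le_measure_hasIsolatedSimplex h1 h2 hε hr (fun i => by linarith [hL i]) (hD x hx) ha
          (hB x hx)
    _ = ∫⁻ ω, ∑ x ∈ F, (G x).indicator 1 ω ∂μ := by
        rw [lintegral_finsetSum _ fun x _ => measurable_one.indicator (hG x)]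
        exact Finset.sum_congr rfl fun x _ => (lintegral_indicator_one (hG x)).symm
    _ ≤ _ := by
        refine lintegral_mono_ae ?_
        filter_upwards [hP.ae_finite hlam] with ω hω
        have h3 : ∑ x ∈ F, (G x).indicator (1 : Ω → ENNReal) ω =
            ((F.filter fun x => ω ∈ G x).card : ENNReal) := by
          simp [Set.indicator_apply]
        rw [h3]
        have h4 := card_le_betti 𝕂 h1 h2 hr hL hω (F := F.filter fun x => ω ∈ G x)
          (fun x hx y hy => hF x (Finset.mem_of_mem_filter x hx) y (Finset.mem_of_mem_filter y hy))
          (fun x hx => (Finset.mem_filter.1 hx).2)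
        exact_mod_cast h4

end IsolatedSimplices

/-! ### Packing of centres and Lebesgue differentiation -/

section Packing

variable {d : ℕ}

theorem volume_closedBall (x : EuclideanSpace ℝ (Fin d)) {r : ℝ} (hr : 0 ≤ r) :
    volume (Metric.closedBall x r) =
      ENNReal.ofReal (r ^ d * volume.real (Metric.ball (0 : EuclideanSpace ℝ (Fin d)) 1)) := by
  rw [Measure.addHaar_closedBall _ _ hr, finrank_euclideanSpace_fin,
    ENNReal.ofReal_mul (pow_nonneg hr d), ofReal_measureReal]

theorem volume_real_unitBall_pos :
    0 < volume.real (Metric.ball (0 : EuclideanSpace ℝ (Fin d)) 1) :=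
  ENNReal.toReal_pos (Metric.measure_ball_pos _ _ one_pos).ne' measure_ball_lt_top.ne

/-- Greedy choice: the `ρ`-balls about the points chosen so far have too little volume to cover `Y`.
Subadditivity suffices, so `Y` need not be measurable. -/
theorem exists_separated_finset {Y : Set (EuclideanSpace ℝ (Fin d))} {ρ : ℝ} (hρ : 0 ≤ ρ) (m : ℕ)
    (h : ∀ j < m, (j : ENNReal) * ENNReal.ofReal
      (ρ ^ d * volume.real (Metric.ball (0 : EuclideanSpace ℝ (Fin d)) 1)) < volume Y) :
    ∃ F : Finset (EuclideanSpace ℝ (Fin d)), F.card = m ∧ (∀ x ∈ F, x ∈ Y) ∧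
      ∀ x ∈ F, ∀ y ∈ F, x ≠ y → ρ < dist x y := by
  classical
  induction m with
  | zero => exact ⟨∅, by simp⟩
  | succ m ih =>
    obtain ⟨F, hF, hFY, hFd⟩ := ih fun j hj => h j (hj.trans m.lt_succ_self)
    obtain ⟨x, hxY, hx⟩ : ∃ x ∈ Y, x ∉ ⋃ y ∈ F, Metric.closedBall y ρ := by
      by_contra! hcon
      refine (h m m.lt_succ_self).not_ge ?_
      calc volume Y ≤ volume (⋃ y ∈ F, Metric.closedBall y ρ) := measure_mono hcon
        _ ≤ ∑ y ∈ F, volume (Metric.closedBall y ρ) := measure_biUnion_finset_le _ _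
        _ = _ := by simp [volume_closedBall _ hρ, hF]
    simp only [Set.mem_iUnion, Metric.mem_closedBall, not_exists, not_le] at hx
    refine ⟨insert x F, ?_, ?_, ?_⟩
    · rw [Finset.card_insert_of_notMem fun hxF => ?_, hF]
      have := hx x hxF
      rw [dist_self] at this
      exact absurd this (not_lt.2 hρ)
    · intro y hy
      rcases Finset.mem_insert.1 hy with rfl | hy
      · exact hxY
      · exact hFY y hy
    · intro y hy z hz hne
      rcases Finset.mem_insert.1 hy with rfl | hy' <;>
        rcases Finset.mem_insert.1 hz with rfl | hz'
      · exact absurd rfl hne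
      · exact hx z hz'
      · rw [dist_comm]; exact hx y hy'
      · exact hFd y hy' z hz' hne

theorem IsBoundedDensity.integrable {f : EuclideanSpace ℝ (Fin d) → ℝ}
    (hf : IsBoundedDensity f) : Integrable f := by
  by_contra h
  have h1 := hf.integral_eq_one
  rw [integral_undef h] at h1
  exact zero_ne_one h1

/-- For small radii, a density has mass comparable to the volume on all the balls
`closedBall (x + r v i) (ε r)`, for a set of points `x` whose measure is bounded below. -/
theorem exists_measure_mass_ge {f : EuclideanSpace ℝ (Fin d) → ℝ} (hf : IsBoundedDensity f)
    {m : ℕ} (v : Fin m → EuclideanSpace ℝ (Fin d)) {ε : ℝ} (hε : 0 < ε) {r : ℕ → ℝ}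
    (hr : ∀ n, 0 < r n) (hlim : Tendsto r atTop (𝓝 0)) :
    ∃ η > 0, ∃ c > 0, ∀ᶠ n in atTop, ENNReal.ofReal c ≤
      volume {x | ∀ i, η * r n ^ d ≤ ∫ y in Metric.closedBall (x + r n • v i) (ε * r n), f y} := by
  let V := volume.real (Metric.ball (0 : EuclideanSpace ℝ (Fin d)) 1)
  have hV : 0 < V := volume_real_unitBall_pos
  let avg : ℕ → Fin m → EuclideanSpace ℝ (Fin d) → ℝ := fun n i x =>
    ⨍ y in Metric.closedBall (x + r n • v i) (ε * r n), f y
  have havg : ∀ᵐ x, ∀ i, Tendsto (fun n => avg n i x) atTop (𝓝 (f x)) := by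
    rw [ae_all_iff]
    intro i
    -- The balls are not centred at `x`, but `x` stays within the fixed multiple `‖v i‖ / ε` of
    -- their radius, which is enough for differentiation.
    filter_upwards [IsUnifLocDoublingMeasure.ae_tendsto_average volume
      hf.integrable.locallyIntegrable (‖v i‖ / ε)] with x hx
    refine hx (fun n => x + r n • v i) (fun n => ε * r n) ?_ (Eventually.of_forall fun n => ?_)
    · rw [tendsto_nhdsWithin_iff]
      refine ⟨by simpa using hlim.const_mul ε, Eventually.of_forall fun n => ?_⟩
      exact Set.mem_Ioi.2 (mul_pos hε (hr n))
    · rw [Metric.mem_closedBall, dist_self_add_right, norm_smul, Real.norm_of_nonneg (hr n).le]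
      apply le_of_eq
      field_simp
  -- These countably many sets cover almost all of `{f > 0}`, which is not null, so one of them has
  -- positive measure. Its threshold and starting index are uniform in `x`.
  let Y : ℕ × ℕ → Set (EuclideanSpace ℝ (Fin d)) := fun p =>
    {x | ∀ n ≥ p.2, ∀ i, 1 / ((p.1 : ℝ) + 1) ≤ avg n i x}
  have hY : volume (⋃ p, Y p) ≠ 0 := by
    intro h0
    have h1 : ∀ᵐ x, f x = 0 := by
      filter_upwards [havg, compl_mem_ae_iff.2 h0] with x hx hxY
      by_contra hne
      have hpos : 0 < f x := lt_of_le_of_ne (hf.nonneg x) (Ne.symm hne)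
      obtain ⟨q, hq⟩ := exists_nat_one_div_lt hpos
      have h2 : ∀ᶠ n in atTop, ∀ i, 1 / ((q : ℝ) + 1) ≤ avg n i x := by
        rw [eventually_all]
        intro i
        filter_upwards [(hx i).eventually_const_lt hq] with n hn using hn.le
      obtain ⟨n₀, hn₀⟩ := eventually_atTop.1 h2
      exact hxY (Set.mem_iUnion.2 ⟨(q, n₀), hn₀⟩)
    have h2 := hf.integral_eq_one
    rw [integral_congr_ae h1, integral_zero] at h2
    exact zero_ne_one h2
  obtain ⟨⟨q, n₀⟩, hq⟩ := exists_measure_pos_of_not_measure_iUnion_null hY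
  obtain ⟨c, hc, hcY⟩ : ∃ c > 0, ENNReal.ofReal c ≤ volume (Y (q, n₀)) := by
    refine ⟨(min (volume (Y (q, n₀))) 1).toReal, ENNReal.toReal_pos ?_ ?_, ?_⟩
    · exact (lt_min hq one_pos).ne'
    · exact ne_top_of_le_ne_top ENNReal.one_ne_top (min_le_right _ _)
    · exact ENNReal.ofReal_toReal_le.trans (min_le_left _ _)
  refine ⟨1 / ((q : ℝ) + 1) * (ε ^ d * V), by positivity, c, hc, ?_⟩
  filter_upwards [eventually_ge_atTop n₀] with n hn
  refine hcY.trans (measure_mono fun x hx i => ?_)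
  have h1 : 1 / ((q : ℝ) + 1) ≤ avg n i x := hx n hn i
  have hrn := hr n
  have h2 : volume.real (Metric.closedBall (x + r n • v i) (ε * r n)) = (ε * r n) ^ d * V := by
    rw [measureReal_def, volume_closedBall _ (by positivity), ENNReal.toReal_ofReal (by positivity)]
  simp only [avg] at h1
  rw [setAverage_eq, h2, smul_eq_mul, inv_mul_eq_div, le_div_iff₀ (by positivity), mul_pow] at h1
  calc _ = 1 / ((q : ℝ) + 1) * (ε ^ d * r n ^ d * V) := by ring
    _ ≤ _ := h1

end Packing

/-! ### Assembly of the two bounds -/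

section Main

variable {d : ℕ} {f : EuclideanSpace ℝ (Fin d) → ℝ}

theorem IsBoundedDensity.setLIntegral_eq (hf : IsBoundedDensity f) (n : ℕ)
    (A : Set (EuclideanSpace ℝ (Fin d))) :
    ∫⁻ x in A, ENNReal.ofReal (n * f x) = ENNReal.ofReal (n * ∫ x in A, f x) := by
  rw [← integral_const_mul, ofReal_integral_eq_lintegral_ofReal]
  · exact (hf.integrable.const_mul _).integrableOn
  · exact Eventually.of_forall fun x => mul_nonneg (Nat.cast_nonneg n) (hf.nonneg x)

theorem IsBoundedDensity.lintegral_eq (hf : IsBoundedDensity f) (n : ℕ) :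
    ∫⁻ x, ENNReal.ofReal (n * f x) = n := by
  rw [← setLIntegral_univ, hf.setLIntegral_eq, setIntegral_univ, hf.integral_eq_one, mul_one,
    ENNReal.ofReal_natCast]

theorem IsBoundedDensity.exists_closedBall_bound (hf : IsBoundedDensity f) :
    ∃ C > 0, ∀ (n : ℕ) (x : EuclideanSpace ℝ (Fin d)) (r : ℝ), 0 ≤ r →
      ∫⁻ y in Metric.closedBall x r, ENNReal.ofReal (n * f y) ≤
        ENNReal.ofReal (C * (n * r ^ d)) := by
  obtain ⟨C, hC⟩ := hf.bounded
  have hV := volume_real_unitBall_pos (d := d)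
  refine ⟨max C 1 * volume.real (Metric.ball (0 : EuclideanSpace ℝ (Fin d)) 1), by positivity,
    fun n x r hr => ?_⟩
  calc ∫⁻ y in Metric.closedBall x r, ENNReal.ofReal (n * f y)
      ≤ ∫⁻ _y in Metric.closedBall x r, ENNReal.ofReal (n * max C 1) := by
        refine lintegral_mono fun y => ENNReal.ofReal_le_ofReal ?_
        gcongr
        exact (hC y).trans (le_max_left _ _)
    _ = _ := by
        rw [setLIntegral_const, volume_closedBall x hr, ← ENNReal.ofReal_mul (by positivity)]
        congr 1
        ring

variable {Ω : Type*} [MeasurableSpace Ω] {μ : Measure Ω}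
  {P : ℕ → Ω → Set (EuclideanSpace ℝ (Fin d))}

theorem exists_lintegral_betti_le (hf : IsBoundedDensity f)
    (hP : ∀ n : ℕ, IsPoissonProcess μ (P n) fun x => n * f x) (𝕂 : Type*) [Field 𝕂] (k : ℕ)
    {r : ℕ → ℝ} (hr : ∀ n, 0 < r n) :
    ∃ C > 0, ∀ n, ∫⁻ ω, (betti 𝕂 (k + 1) (P n ω) (r n) : ENNReal) ∂μ ≤
      ENNReal.ofReal (C * (n * (r n ^ d * n) ^ (k + 2))) := by
  obtain ⟨C, hC, hball⟩ := hf.exists_closedBall_bound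
  refine ⟨(C * (d * 4) ^ d + 1) ^ (k + 2) * 7 ^ d, by positivity, fun n => ?_⟩
  have hrn := hr n
  have hlam : ∫⁻ x, ENNReal.ofReal (n * f x) ≠ ⊤ := by
    rw [hf.lintegral_eq]; exact ENNReal.natCast_ne_top n
  refine ((hP n).lintegral_betti_le (hf.measurable.const_mul _) hlam 𝕂 k hrn
    (M := ENNReal.ofReal ((C * (d * 4) ^ d + 1) * (r n ^ d * n))) fun z => ?_).trans (le_of_eq ?_)
  · refine (lintegral_mono_set (cellNeighbourhood_subset_closedBall hrn z)).trans
      ((hball n _ _ (by positivity)).trans (ENNReal.ofReal_le_ofReal ?_))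
    calc C * (n * (d * (4 * r n)) ^ d) = C * (d * 4) ^ d * (r n ^ d * n) := by
          rw [← mul_assoc (d : ℝ), mul_pow]; ring
      _ ≤ _ := by gcongr; linarith
  · rw [hf.lintegral_eq, ← ENNReal.ofReal_pow (by positivity), ← ENNReal.ofReal_natCast n,
      show (7 : ENNReal) = ENNReal.ofReal 7 by simp, ← ENNReal.ofReal_pow (by positivity),
      ← ENNReal.ofReal_mul (by positivity), ← ENNReal.ofReal_mul (by positivity)]
    congr 1
    rw [mul_pow (C * (d * 4) ^ d + 1)]
    ring

theorem exists_le_lintegral_betti [IsProbabilityMeasure μ] (hd : d ≠ 0) (hf : IsBoundedDensity f)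
    (hP : ∀ n : ℕ, IsPoissonProcess μ (P n) fun x => n * f x) (𝕂 : Type*) [Field 𝕂] {k : ℕ}
    (hkd : k + 1 ≤ d) {r : ℕ → ℝ} (hr : ∀ n, 0 < r n)
    (hlim : Tendsto (fun n : ℕ => r n ^ d * n) atTop (𝓝 0)) :
    ∃ c > 0, ∀ᶠ n : ℕ in atTop, ENNReal.ofReal (c * (n * (r n ^ d * n) ^ (k + 1))) ≤
      ∫⁻ ω, (betti 𝕂 k (P n ω) (r n) : ENNReal) ∂μ := by
  obtain ⟨v, ε, hε, h1, h2⟩ := exists_robust_empty_simplex (Nat.succ_pos k) hkd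
  have hr0 : Tendsto r atTop (𝓝 0) := by
    -- For `n ≥ 1` one has `r n ^ d ≤ r n ^ d * n`, so the radii tend to zero.
    have h3 : Tendsto (fun n => r n ^ d) atTop (𝓝 0) := by
      refine squeeze_zero' (Eventually.of_forall fun n => pow_nonneg (hr n).le d) ?_ hlim
      filter_upwards [eventually_ge_atTop 1] with n hn
      exact le_mul_of_one_le_right (pow_nonneg (hr n).le d) (by exact_mod_cast hn)
    have h4 := h3.rpow_const (p := (d : ℝ)⁻¹) (Or.inr (by positivity))
    rw [Real.zero_rpow (by positivity)] at h4
    exact h4.congr fun n => Real.pow_rpow_inv_natCast (hr n).le hd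
  obtain ⟨L, hL0, hL⟩ : ∃ L : ℝ, 0 < L ∧ ∀ i, ‖v i‖ + ε + 2 ≤ L := by
    refine ⟨∑ i, ‖v i‖ + ε + 2, by positivity, fun i => ?_⟩
    have := Finset.single_le_sum (fun j _ => norm_nonneg (v j)) (Finset.mem_univ i)
    linarith
  obtain ⟨η, hη, c, hc, hmass⟩ := exists_measure_mass_ge hf v hε hr hr0
  obtain ⟨C, hC, hball⟩ := hf.exists_closedBall_bound
  set V := volume.real (Metric.ball (0 : EuclideanSpace ℝ (Fin d)) 1)
  have hV : 0 < V := volume_real_unitBall_pos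
  have hsmall : ∀ᶠ n : ℕ in atTop, C * (L ^ d * (r n ^ d * n)) < 1 := by
    have h3 := (hlim.const_mul (L ^ d)).const_mul C
    rw [mul_zero, mul_zero] at h3
    exact h3.eventually_lt_const one_pos
  refine ⟨c / ((2 * L) ^ d * V) * (Real.exp (-1) * (Real.exp (-1) * η) ^ (k + 2)), by positivity, ?_⟩
  filter_upwards [hmass, hsmall] with n hmass hsmall
  have hrn := hr n
  have hlam : ∫⁻ x, ENNReal.ofReal (n * f x) ≠ ⊤ := by
    rw [hf.lintegral_eq]; exact ENNReal.natCast_ne_top n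
  obtain ⟨F, hF, hFY, hFd⟩ := exists_separated_finset (ρ := 2 * (L * r n)) (by positivity)
    -- Every `j` below the ceiling is strictly below the quotient, which is precisely the greedy
    -- condition; the number of centres is of order `r n ^ (-d)`.
    ⌈c / ((2 * (L * r n)) ^ d * V)⌉₊ fun j hj => by
      refine lt_of_lt_of_le ?_ hmass
      rw [Nat.lt_ceil, lt_div_iff₀ (by positivity)] at hj
      rw [← ENNReal.ofReal_natCast j, ← ENNReal.ofReal_mul (by positivity)]
      exact (ENNReal.ofReal_lt_ofReal_iff hc).2 hj
  refine le_trans ?_ ((hP n).le_lintegral_betti hlam 𝕂 h1 h2 hε.le hrn hL hFd (fun x _ => ?_)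
    (a := n * (η * r n ^ d)) (by positivity) (fun x hx i => ?_))
  · rw [hF, ← ENNReal.ofReal_natCast, ← ENNReal.ofReal_mul (by positivity)]
    refine ENNReal.ofReal_le_ofReal ?_
    -- The factor `r n ^ (-d)` from the packing cancels one `r n ^ d` and leaves a bare `n`.
    calc c / ((2 * L) ^ d * V) * (Real.exp (-1) * (Real.exp (-1) * η) ^ (k + 2)) *
          (n * (r n ^ d * n) ^ (k + 1))
        = c / ((2 * (L * r n)) ^ d * V) *
          (Real.exp (-1) * (Real.exp (-1) * (n * (η * r n ^ d))) ^ (k + 2)) := by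
          rw [← mul_assoc 2 L, mul_pow (2 * L)]
          field_simp
          simp only [mul_pow]
          ring
      _ ≤ _ := by gcongr; exact Nat.le_ceil _
  · refine (hball n x _ (by positivity)).trans ?_
    rw [ENNReal.ofReal_le_one, mul_pow]
    linarith
  · rw [hf.setLIntegral_eq]
    refine ENNReal.ofReal_le_ofReal ?_
    gcongr
    exact hFY x hx i

end Main

end RandomCech

theorem mainTheorem2 (d k : ℕ) (hd : 2 ≤ d) (hk : 1 ≤ k) (hkd : k ≤ d - 1)
    (𝕂 : Type*) [Field 𝕂]
    (f : EuclideanSpace ℝ (Fin d) → ℝ) (hf : RandomCech.IsBoundedDensity f)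
    {Ω : Type*} [MeasurableSpace Ω] (μ : Measure Ω) [IsProbabilityMeasure μ]
    (P : ℕ → Ω → Set (EuclideanSpace ℝ (Fin d)))
    (hP : ∀ n : ℕ, RandomCech.IsPoissonProcess μ (P n) (fun x => n * f x))
    (r : ℕ → ℝ) (hr : ∀ n, 0 < r n)
    (hlim : Tendsto (fun n : ℕ => r n ^ d * n) atTop (𝓝 0)) :
    RandomCech.IsMinVertices 𝕂 d 1 k (k + 2) ∧
    (∀ n, Integrable (fun ω => (RandomCech.betti 𝕂 k (P n ω) (r n) : ℝ)) μ) ∧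
    (fun n : ℕ => ∫ ω, (RandomCech.betti 𝕂 k (P n ω) (r n) : ℝ) ∂μ) =Θ[atTop]
      (fun n : ℕ => (n : ℝ) * (r n ^ d * n) ^ (k + 1)) := by
  have hkd' : k + 1 ≤ d := by omega
  obtain ⟨C, hC, hupper⟩ : ∃ C > 0, ∀ n, ∫⁻ ω, (RandomCech.betti 𝕂 k (P n ω) (r n) : ENNReal) ∂μ ≤
      ENNReal.ofReal (C * (n * (r n ^ d * n) ^ (k + 1))) := by
    obtain ⟨k, rfl⟩ := Nat.exists_eq_add_of_le' hk
    exact RandomCech.exists_lintegral_betti_le hf hP 𝕂 k hr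
  obtain ⟨c, hc, hlower⟩ :=
    RandomCech.exists_le_lintegral_betti (by omega) hf hP 𝕂 hkd' hr hlim
  have hmeas : ∀ n, AEStronglyMeasurable (fun ω => (RandomCech.betti 𝕂 k (P n ω) (r n) : ℝ)) μ := by
    intro n
    have hlam : ∫⁻ x, ENNReal.ofReal (n * f x) ≠ ⊤ := by
      rw [hf.lintegral_eq]; exact ENNReal.natCast_ne_top n
    have h := RandomCech.aemeasurable_betti 𝕂 k (hP n).measurable_count
      ((hP n).ae_finite hlam) (r n)
    exact (measurable_from_nat.comp_aemeasurable h : AEMeasurable _ μ).aestronglyMeasurable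
  have hnonneg : ∀ n, 0 ≤ᵐ[μ] fun ω => (RandomCech.betti 𝕂 k (P n ω) (r n) : ℝ) := fun n =>
    Eventually.of_forall fun ω => Nat.cast_nonneg _
  have hint : ∀ n, Integrable (fun ω => (RandomCech.betti 𝕂 k (P n ω) (r n) : ℝ)) μ := by
    intro n
    refine ⟨hmeas n, ?_⟩
    rw [hasFiniteIntegral_iff_ofReal (hnonneg n)]
    simp only [ENNReal.ofReal_natCast]
    exact (hupper n).trans_lt ENNReal.ofReal_lt_top
  -- Both bounds concern the `ENNReal`-valued integral; integrability, itself a consequence of the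
  -- upper bound, transfers them to the real expectation.
  have heq : ∀ n, ∫⁻ ω, (RandomCech.betti 𝕂 k (P n ω) (r n) : ENNReal) ∂μ =
      ENNReal.ofReal (∫ ω, (RandomCech.betti 𝕂 k (P n ω) (r n) : ℝ) ∂μ) := by
    intro n
    rw [ofReal_integral_eq_lintegral_ofReal (hint n) (hnonneg n)]
    simp only [ENNReal.ofReal_natCast]
  have hgrow : ∀ n : ℕ, 0 ≤ (n : ℝ) * (r n ^ d * n) ^ (k + 1) := fun n => by
    have := hr n
    positivity
  have hE : ∀ n, 0 ≤ ∫ ω, (RandomCech.betti 𝕂 k (P n ω) (r n) : ℝ) ∂μ := fun n =>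
    integral_nonneg_of_ae (hnonneg n)
  refine ⟨RandomCech.isMinVertices_one 𝕂 hk hkd', hint, ?_, ?_⟩
  · refine IsBigO.of_bound C (Eventually.of_forall fun n => ?_)
    have h := hupper n
    rw [heq, ENNReal.ofReal_le_ofReal_iff (mul_nonneg hC.le (hgrow n))] at h
    rwa [Real.norm_of_nonneg (hE n), Real.norm_of_nonneg (hgrow n)]
  · refine IsBigO.of_bound c⁻¹ ?_
    filter_upwards [hlower] with n h
    rw [heq, ENNReal.ofReal_le_ofReal_iff (hE n)] at h
    rw [Real.norm_of_nonneg (hE n), Real.norm_of_nonneg (hgrow n), inv_mul_eq_div,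
      le_div_iff₀ hc, mul_comm]
    exact h
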